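/- **Theorem.** Consider the complex Gaussian three-user channel $Y_\ell=\sum_{i=1}^3 h_{\ell i}X_i+Z_\ell$, $\ell=1,2,3$, with power constraints $\mathbb E|X_i|^2\le 1$ and with proper complex Gaussian noises $Z_\ell\sim\mathcal N(0,1)$, taken independent of each other, of the inputs, and across channel uses. Assume that the channel is symmetric in the two primary users: $$h_{11}=h_{22}=|h_{\rm d}|,\qquad h_{12}=h_{21}=h_{\rm i},\qquad h_{13}=h_{23}=h_{\rm c},$$ where $h_{\rm d},h_{\rm i},h_{\rm c}$ and $h_{31},h_{32},h_{33}$ are arbitrary complex numbers with $h_{\rm c}\neq 0$. Suppose that $|h_{33}|^2\le|h_{\rm c}|^2$ and that $$\log\bigl(1+\mathbf h_2^H\mathbf\Sigma\,\mathbf h_2\bigr)\le\log\bigl(1+\mathbf h_1^H\mathbf\Sigma\,\mathbf h_1\bigr),\qquad \mathbf h_2^*=\begin{bmatrix}|h_{\rm d}|\\ h_{\rm c}\end{bmatrix},\quad \mathbf h_1^*=\begin{bmatrix}h_{\rm i}\\ h_{\rm c}\end{bmatrix},\quad \mathbf\Sigma=\begin{bmatrix}1-|\rho_1|^2&\rho_3-\rho_1\rho_2^*\\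 \rho_3^*-\rho_1^*\rho_2&1-|\rho_2|^2\end{bmatrix},$$ for all complex $\rho_1,\rho_2,\rho_3$ with $|\rho_i|\le1$ that are correlation coefficients of some unit-variance inputs, i.e. for which $\mathbf\Sigma\succeq0$. Let $$\overline C=\sup\Bigl\{I(Y_1;X_1,X_2,X_3)+I(Y_2;X_2,X_3\mid X_1,Y_1)+I(Y_3;X_3\mid X_1,X_2,Y_1,Y_2)\Bigr\}$$ (in bits), where the supremum is over all joint laws of $(X_1,X_2,X_3)$ with $\mathbb E|X_i|^2\le1$ for each $i$; this is the sum-capacity outer bound of the channel with cumulative message sharing, in which transmitter $i$ knows the messages $W_1,\dots,W_i$. Then there is a rate pair $(R_1,R_2)$ with $$\overline C\le R_1+R_2+3$$ that is achievable with the message knowledge of an interference channel with a cognitive relay: transmitters 1 and 2 know only their own messages $W_1$ and $W_2$, transmitter 3 knows $(W_1,W_2)$ and has no message of its own, receivers 1 and 2 decode $W_1$ and $W_2$ respectively, and the average error probabilities tend to $0$ as the block length $N\to\infty$, under the power constraint $\frac1N\sum_{t=1}^N\mathbb E|X_{i,t}|^2\le1$ for each transmitter. Moreover, $(R_1,R_2)$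 is achieved by codes in which transmitter 3 beamforms the primary codewords, $X_3^N=aX_1^N+bX_2^N$ with constants $a,b\in\mathbb C$ not depending on $N$, and in which receivers 1 and 2 both decode the pair $(W_1,W_2)$ with vanishing error probability, as in a compound multiple-access channel. -/

import Mathlib

open MeasureTheory ProbabilityTheory Filter Topology
open scoped ENNReal Matrix ComplexConjugate ComplexOrder

noncomputable section

namespace CIFC

/-- The law `𝒩(0,1)` of a proper (circularly symmetric) complex Gaussian random variable with mean
`0` and variance `1`: independent real and imaginary parts, each of variance `1/2`. -/
def stdComplexGaussian : Measure ℂ :=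
  ((gaussianReal 0 (1 / 2)).prod (gaussianReal 0 (1 / 2))).map
    (fun p : ℝ × ℝ => (p.1 : ℂ) + (p.2 : ℂ) * Complex.I)

instance : IsProbabilityMeasure stdComplexGaussian := by
  unfold stdComplexGaussian
  exact Measure.isProbabilityMeasure_map (by fun_prop)

/-- Channel matrix of the symmetric three-user Gaussian channel; the entry in row `ℓ` and column
`i` is the gain from transmitter `i` to receiver `ℓ` (indices `0, 1, 2` for users `1, 2, 3`).
The gains into the cognitive receiver (last row) are arbitrary. -/
def symmetricGains (hd hi hc h31 h32 h33 : ℂ) : Matrix (Fin 3) (Fin 3) ℂ :=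
  !![(‖hd‖ : ℂ), hi, hc;
     hi, (‖hd‖ : ℂ), hc;
     h31, h32, h33]

/-! ### Mutual information, in bits -/

section Information

variable {Ω α β γ : Type*} [MeasurableSpace Ω] [MeasurableSpace α] [MeasurableSpace β]
  [MeasurableSpace γ]

/-- `I(A; B)` in bits. -/
def mutualInfo (A : Ω → α) (B : Ω → β) (μ : Measure Ω) : ℝ≥0∞ :=
  InformationTheory.klDiv (μ.map (fun ω => (A ω, B ω))) ((μ.map A).prod (μ.map B))
    / ENNReal.ofReal (Real.log 2)

/-- `I(A; B | C)` in bits: the divergence of the joint law of `(C, A, B)` from the law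
`P_C P_{A|C} P_{B|C}` under which `A` and `B` are conditionally independent given `C`. -/
def condMutualInfo [StandardBorelSpace α] [Nonempty α] [StandardBorelSpace β] [Nonempty β]
    (A : Ω → α) (B : Ω → β) (C : Ω → γ) (μ : Measure Ω) [IsFiniteMeasure μ] : ℝ≥0∞ :=
  InformationTheory.klDiv (μ.map (fun ω => (C ω, A ω, B ω)))
      ((μ.map C) ⊗ₘ (condDistrib A C μ ×ₖ condDistrib B C μ))
    / ENNReal.ofReal (Real.log 2)

end Information

/-! ### The sum-capacity outer bound for cumulative message sharing -/

/-- Law of inputs and noises `(X, Z)` in one channel use: `X ~ P`, and `Z` is independent of `X`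
with i.i.d. `𝒩(0,1)` components. -/
def inputNoiseLaw (P : Measure (Fin 3 → ℂ)) : Measure ((Fin 3 → ℂ) × (Fin 3 → ℂ)) :=
  P.prod (Measure.pi fun _ => stdComplexGaussian)

instance (P : Measure (Fin 3 → ℂ)) [IsProbabilityMeasure P] :
    IsProbabilityMeasure (inputNoiseLaw P) := by
  unfold inputNoiseLaw; infer_instance

/-- The channel input `X_i`. -/
def inputX (i : Fin 3) (ω : (Fin 3 → ℂ) × (Fin 3 → ℂ)) : ℂ := ω.1 i

/-- The channel output `Y_ℓ = ∑ i, h_{ℓ i} X_i + Z_ℓ`. -/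
def outputY (H : Matrix (Fin 3) (Fin 3) ℂ) (l : Fin 3) (ω : (Fin 3 → ℂ) × (Fin 3 → ℂ)) : ℂ :=
  ∑ i, H l i * ω.1 i + ω.2 l

/-- The right-hand side of the sum-rate bound, for the joint input law `P`:
`I(Y₁; X₁,X₂,X₃) + I(Y₂; X₂,X₃ | X₁,Y₁) + I(Y₃; X₃ | X₁,X₂,Y₁,Y₂)`. -/
def cmsSumRateBound (H : Matrix (Fin 3) (Fin 3) ℂ) (P : Measure (Fin 3 → ℂ))
    [IsProbabilityMeasure P] : ℝ≥0∞ :=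
  mutualInfo (outputY H 0) (fun ω => (inputX 0 ω, inputX 1 ω, inputX 2 ω)) (inputNoiseLaw P)
  + condMutualInfo (outputY H 1) (fun ω => (inputX 1 ω, inputX 2 ω))
      (fun ω => (inputX 0 ω, outputY H 0 ω)) (inputNoiseLaw P)
  + condMutualInfo (outputY H 2) (inputX 2)
      (fun ω => (inputX 0 ω, inputX 1 ω, outputY H 0 ω, outputY H 1 ω)) (inputNoiseLaw P)

/-- The sum-capacity outer bound of the three-user channel with cumulative message sharing: the
sum-rate bound, maximized over all joint input laws with `E|X_i|² ≤ 1`. -/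
def cmsSumCapacityOuterBound (H : Matrix (Fin 3) (Fin 3) ℂ) : ℝ≥0∞ :=
  ⨆ (P : Measure (Fin 3 → ℂ)) (_ : IsProbabilityMeasure P)
    (_ : ∀ i, ∫⁻ x, ENNReal.ofReal (‖x i‖ ^ 2) ∂P ≤ 1), cmsSumRateBound H P

/-! ### Codes with the message knowledge of the interference channel with a cognitive relay -/

/-- Block output of receiver `l` for block inputs `x` and noise block `z`. -/
def received {N : ℕ} (H : Matrix (Fin 3) (Fin 3) ℂ) (l : Fin 3) (x : Fin 3 → Fin N → ℂ)
    (z : Fin N → ℂ) : Fin N → ℂ :=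
  fun t => ∑ i, H l i * x i t + z t

/-- A block of `N` i.i.d. `𝒩(0,1)` noises. -/
def blockNoise (N : ℕ) : Measure (Fin N → ℂ) := Measure.pi fun _ => stdComplexGaussian

/-- A code of block length `N` with IFC+CR message knowledge: transmitters 1 and 2 each know
their own message only, transmitter 3 has no message of its own and knows both, and receivers
1 and 2 each estimate their own message. -/
structure IFCCRCode (N M₁ M₂ : ℕ) where
  enc₁ : Fin M₁ → Fin N → ℂ
  enc₂ : Fin M₂ → Fin N → ℂ
  enc₃ : Fin M₁ → Fin M₂ → Fin N → ℂ
  dec₁ : (Fin N → ℂ) → Fin M₁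
  dec₂ : (Fin N → ℂ) → Fin M₂
  measurable_dec₁ : Measurable dec₁
  measurable_dec₂ : Measurable dec₂

namespace IFCCRCode

variable {N M₁ M₂ : ℕ}

/-- The three transmitted blocks for the message pair `(w₁, w₂)`. -/
def input (c : IFCCRCode N M₁ M₂) (w₁ : Fin M₁) (w₂ : Fin M₂) : Fin 3 → Fin N → ℂ :=
  ![c.enc₁ w₁, c.enc₂ w₂, c.enc₃ w₁ w₂]

/-- `(1/N) ∑ t, E|X_{i,t}|² ≤ 1` for each transmitter `i`, with the expectation over independent
uniform messages. -/
def PowerConstraint (c : IFCCRCode N M₁ M₂) : Prop :=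
  ∀ i, ∑ w₁, ∑ w₂, ∑ t, ‖c.input w₁ w₂ i t‖ ^ 2 ≤ (N : ℝ) * (M₁ * M₂)

/-- `ℙ[Ŵ₁ ≠ W₁]`, averaged over independent uniform messages. -/
def error₁ (H : Matrix (Fin 3) (Fin 3) ℂ) (c : IFCCRCode N M₁ M₂) : ℝ :=
  (∑ w₁, ∑ w₂, (blockNoise N).real {z | c.dec₁ (received H 0 (c.input w₁ w₂) z) ≠ w₁})
    / ((M₁ : ℝ) * M₂)

/-- `ℙ[Ŵ₂ ≠ W₂]`, averaged over independent uniform messages. -/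
def error₂ (H : Matrix (Fin 3) (Fin 3) ℂ) (c : IFCCRCode N M₁ M₂) : ℝ :=
  (∑ w₁, ∑ w₂, (blockNoise N).real {z | c.dec₂ (received H 1 (c.input w₁ w₂) z) ≠ w₂})
    / ((M₁ : ℝ) * M₂)

end IFCCRCode

/-- Number of messages at rate `R` bits per channel use and block length `N`. -/
def numMessages (N : ℕ) (R : ℝ) : ℕ := ⌈(2 : ℝ) ^ ((N : ℝ) * R)⌉₊

/-- `(R₁, R₂)` is an achievable rate pair with IFC+CR message knowledge. -/
def IFCCRAchievable (H : Matrix (Fin 3) (Fin 3) ℂ) (R₁ R₂ : ℝ) : Prop :=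
  0 ≤ R₁ ∧ 0 ≤ R₂ ∧
    ∃ c : ∀ N : ℕ, IFCCRCode N (numMessages N R₁) (numMessages N R₂),
      (∀ N, (c N).PowerConstraint) ∧
      Tendsto (fun N => max ((c N).error₁ H) ((c N).error₂ H)) atTop (𝓝 0)

/-- A code in which transmitter 3 beamforms the primary codewords, sending
`a X₁ + b X₂`, and in which receivers 1 and 2 both decode both messages
(a compound multiple-access channel). -/
structure BeamformingCode (N M₁ M₂ : ℕ) where
  enc₁ : Fin M₁ → Fin N → ℂ
  enc₂ : Fin M₂ → Fin N → ℂ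
  dec₁ : (Fin N → ℂ) → Fin M₁ × Fin M₂
  dec₂ : (Fin N → ℂ) → Fin M₁ × Fin M₂
  measurable_dec₁ : Measurable dec₁
  measurable_dec₂ : Measurable dec₂

namespace BeamformingCode

variable {N M₁ M₂ : ℕ}

/-- The underlying code with IFC+CR message knowledge. -/
def toIFCCR (c : BeamformingCode N M₁ M₂) (a b : ℂ) : IFCCRCode N M₁ M₂ where
  enc₁ := c.enc₁
  enc₂ := c.enc₂
  enc₃ := fun w₁ w₂ t => a * c.enc₁ w₁ t + b * c.enc₂ w₂ t
  dec₁ := fun y => (c.dec₁ y).1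
  dec₂ := fun y => (c.dec₂ y).2
  measurable_dec₁ := c.measurable_dec₁.fst
  measurable_dec₂ := c.measurable_dec₂.snd

/-- Average probability that receiver 1 does not recover the pair `(W₁, W₂)`. -/
def jointError₁ (H : Matrix (Fin 3) (Fin 3) ℂ) (c : BeamformingCode N M₁ M₂) (a b : ℂ) : ℝ :=
  (∑ w₁, ∑ w₂, (blockNoise N).real
      {z | c.dec₁ (received H 0 ((c.toIFCCR a b).input w₁ w₂) z) ≠ (w₁, w₂)})
    / ((M₁ : ℝ) * M₂)

/-- Average probability that receiver 2 does not recover the pair `(W₁, W₂)`. -/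
def jointError₂ (H : Matrix (Fin 3) (Fin 3) ℂ) (c : BeamformingCode N M₁ M₂) (a b : ℂ) : ℝ :=
  (∑ w₁, ∑ w₂, (blockNoise N).real
      {z | c.dec₂ (received H 1 ((c.toIFCCR a b).input w₁ w₂) z) ≠ (w₁, w₂)})
    / ((M₁ : ℝ) * M₂)

end BeamformingCode

/-- `(R₁, R₂)` is achieved by beamforming the primary codewords at transmitter 3, with weights
that do not depend on the block length, and compound-MAC decoding at receivers 1 and 2. -/
def BeamformingAchievable (H : Matrix (Fin 3) (Fin 3) ℂ) (R₁ R₂ : ℝ) : Prop :=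
  0 ≤ R₁ ∧ 0 ≤ R₂ ∧
    ∃ (a b : ℂ) (c : ∀ N : ℕ, BeamformingCode N (numMessages N R₁) (numMessages N R₂)),
      (∀ N, ((c N).toIFCCR a b).PowerConstraint) ∧
      Tendsto (fun N => max ((c N).jointError₁ H a b) ((c N).jointError₂ H a b)) atTop (𝓝 0)

/-! ### The strong-interference condition -/

/-- Conditional covariance of `(X₂, X₃)` given `X₁` for unit-variance jointly Gaussian inputs with
`ρ₁ = E[X₂ X₁*]`, `ρ₂ = E[X₃ X₁*]`, `ρ₃ = E[X₂ X₃*]`. -/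
def condCov (ρ₁ ρ₂ ρ₃ : ℂ) : Matrix (Fin 2) (Fin 2) ℂ :=
  !![1 - (‖ρ₁‖ : ℂ) ^ 2, ρ₃ - ρ₁ * conj ρ₂;
     conj ρ₃ - conj ρ₁ * ρ₂, 1 - (‖ρ₂‖ : ℂ) ^ 2]

/-- The real number `hᴴ S h` (for Hermitian `S`), where `h* = (u, v)`. -/
def quadForm (S : Matrix (Fin 2) (Fin 2) ℂ) (u v : ℂ) : ℝ :=
  (![u, v] ⬝ᵥ (S *ᵥ star ![u, v])).re

/-- The strong-interference condition
`log (1 + h₂ᴴ Σ h₂) ≤ log (1 + h₁ᴴ Σ h₁)` with `h₂* = (|h_d|, h_c)` and `h₁* = (h_i, h_c)`, for all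
correlation parameters. Positive semidefiniteness of `Σ` says that the `ρ`'s are the correlations
of some triple of unit-variance inputs. -/
def StrongInterference (hd hi hc : ℂ) : Prop :=
  ∀ ρ₁ ρ₂ ρ₃ : ℂ, ‖ρ₁‖ ≤ 1 → ‖ρ₂‖ ≤ 1 → ‖ρ₃‖ ≤ 1 → (condCov ρ₁ ρ₂ ρ₃).PosSemidef →
    Real.logb 2 (1 + quadForm (condCov ρ₁ ρ₂ ρ₃) (‖hd‖ : ℂ) hc) ≤
      Real.logb 2 (1 + quadForm (condCov ρ₁ ρ₂ ρ₃) hi hc)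

end CIFC

end

/-!
Testing the strong-interference condition on degenerate conditional covariances, with
`X₂ = w X₃` given `X₁`, yields `‖|h_d| w + h_c‖ ≤ ‖h_i w + h_c‖` for all `‖w‖ ≤ 1`, hence
`h_i = |h_d|`: the two primary receivers observe the same combination `S` of the inputs in
independent noises.

*Outer bound.* The first mutual information is at most `log₂ (1 + g²)`, where `g` is the sum of the
moduli of the gains. Given `Y₁ = S + Z₁`, the output `Y₂ = Y₁ + (Z₂ - Z₁)` conveys at most one bit,
and, given `X₁`, `X₂` and `Y₁`, so does `Y₃`, which is a function of these plus a multiple of `Z₁`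
of modulus at most one plus `Z₃`. Each bound compares the conditional law of the output with a
Gaussian law of suitable mean and variance.

*Achievability.* The relay splits its power equally between the primary codewords and aligns each
with the direct signal. The primary transmitters take turns, for fractions of the time
proportional to their received powers, so that the sum rate is `log₂ (1 + T)` with `T` the total
received power, and `g² ≤ 2 T`. The codes for each turn come from Feinstein's maximal code
argument with Gaussian codewords.
-/

open scoped NNReal

noncomputable section

namespace CIFC

/-! ### Complex Gaussian measures -/

/-- The centred proper complex Gaussian law of variance `v`: independent real and imaginary parts,
each of variance `v / 2`. -/
def complexGaussian (v : ℝ≥0) : Measure ℂ :=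
  ((gaussianReal 0 (v / 2)).prod (gaussianReal 0 (v / 2))).map
    (fun p : ℝ × ℝ => (p.1 : ℂ) + (p.2 : ℂ) * Complex.I)

instance (v : ℝ≥0) : IsProbabilityMeasure (complexGaussian v) := by
  unfold complexGaussian
  exact Measure.isProbabilityMeasure_map (by fun_prop)

lemma complexGaussian_one : complexGaussian 1 = stdComplexGaussian := rfl

lemma charFun_complexGaussian (v : ℝ≥0) (t : ℂ) :
    charFun (complexGaussian v) t = Complex.exp (-(v * ‖t‖ ^ 2 / 4 : ℝ)) := by
  rw [charFun_apply, complexGaussian, integral_map (by fun_prop) (by fun_prop)]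
  have hsplit : ∀ p : ℝ × ℝ,
      Complex.exp (inner ℝ ((p.1 : ℂ) + (p.2 : ℂ) * Complex.I) t * Complex.I) =
        Complex.exp (t.re * p.1 * Complex.I) * Complex.exp (t.im * p.2 * Complex.I) := by
    intro p
    rw [← Complex.exp_add, Complex.inner]
    congr 1
    simp
    ring
  simp_rw [hsplit]
  rw [integral_prod_mul (fun x : ℝ => Complex.exp (t.re * x * Complex.I))
    (fun y : ℝ => Complex.exp (t.im * y * Complex.I)), ← charFun_apply_real, ← charFun_apply_real,
    charFun_gaussianReal, charFun_gaussianReal, ← Complex.exp_add, ← Complex.normSq_eq_norm_sq,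
    Complex.normSq_apply]
  congr 1
  push_cast
  ring

lemma complexGaussian_conv_complexGaussian (v w : ℝ≥0) :
    complexGaussian v ∗ complexGaussian w = complexGaussian (v + w) := by
  refine Measure.ext_of_charFun (funext fun t => ?_)
  simp only [charFun_conv, charFun_complexGaussian, ← Complex.exp_add]
  congr 1
  push_cast
  ring

/-- The density of the proper complex Gaussian law of mean `m` and variance `v`. -/
def complexGaussianPDF (m : ℂ) (v : ℝ) (z : ℂ) : ℝ :=
  (Real.pi * v)⁻¹ * Real.exp (-‖z - m‖ ^ 2 / v)

@[fun_prop]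
lemma measurable_complexGaussianPDF {α : Type*} [MeasurableSpace α] {f g : α → ℂ} {v : ℝ}
    (hf : Measurable f) (hg : Measurable g) :
    Measurable (fun a => complexGaussianPDF (f a) v (g a)) := by
  unfold complexGaussianPDF
  fun_prop

lemma complexGaussianPDF_pos (m : ℂ) {v : ℝ} (hv : 0 < v) (z : ℂ) :
    0 < complexGaussianPDF m v z := by
  unfold complexGaussianPDF; positivity

lemma norm_sq_add_mul_I (x y : ℝ) : ‖(x : ℂ) + (y : ℂ) * Complex.I‖ ^ 2 = x ^ 2 + y ^ 2 := by
  rw [← Complex.normSq_eq_norm_sq, Complex.normSq_add_mul_I]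

lemma gaussianPDF_mul_gaussianPDF (v : ℝ≥0) (x y : ℝ) :
    gaussianPDF 0 (v / 2) x * gaussianPDF 0 (v / 2) y =
      ENNReal.ofReal (complexGaussianPDF 0 v ((x : ℂ) + (y : ℂ) * Complex.I)) := by
  rw [gaussianPDF, gaussianPDF, ← ENNReal.ofReal_mul (gaussianPDFReal_nonneg _ _ _)]
  congr 1
  simp only [gaussianPDFReal, complexGaussianPDF, sub_zero, norm_sq_add_mul_I]
  have hcoe : 2 * ((v / 2 : ℝ≥0) : ℝ) = v := by push_cast; ring
  rw [mul_mul_mul_comm, ← mul_inv, Real.mul_self_sqrt (by positivity), ← Real.exp_add,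
    mul_right_comm, hcoe, mul_comm (v : ℝ)]
  congr 2
  ring

lemma complexGaussian_eq_withDensity {v : ℝ≥0} (hv : v ≠ 0) :
    complexGaussian v =
      volume.withDensity (fun z => ENNReal.ofReal (complexGaussianPDF 0 v z)) := by
  have hsymm : (fun p : ℝ × ℝ => (p.1 : ℂ) + (p.2 : ℂ) * Complex.I) =
      Complex.measurableEquivRealProd.symm := by
    ext p
    exact (Complex.mk_eq_add_mul_I p.1 p.2).symm
  have hv2 : v / 2 ≠ 0 := by positivity
  refine Measure.ext_of_lintegral _ fun F hF => ?_
  rw [complexGaussian, hsymm, gaussianReal_of_var_ne_zero _ hv2,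
    prod_withDensity (measurable_gaussianPDF _ _) (measurable_gaussianPDF _ _),
    lintegral_map hF (MeasurableEquiv.measurable _),
    lintegral_withDensity_eq_lintegral_mul _ (by fun_prop) (by fun_prop),
    lintegral_withDensity_eq_lintegral_mul _ (by fun_prop) hF,
    ← (Complex.volume_preserving_equiv_real_prod.symm _).lintegral_comp (by fun_prop),
    Measure.volume_eq_prod]
  simp only [← hsymm, gaussianPDF_mul_gaussianPDF, Pi.mul_apply]

lemma lintegral_complexGaussian_add_left (m : ℂ) {v : ℝ≥0} (hv : v ≠ 0) {F : ℂ → ℝ≥0∞}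
    (hF : Measurable F) :
    ∫⁻ z, F (m + z) ∂complexGaussian v =
      ∫⁻ y, F y * ENNReal.ofReal (complexGaussianPDF m v y) := by
  rw [complexGaussian_eq_withDensity hv,
    lintegral_withDensity_eq_lintegral_mul _ (by fun_prop) (by fun_prop),
    ← lintegral_sub_right_eq_self _ m]
  refine lintegral_congr fun z => ?_
  simp only [Pi.mul_apply, complexGaussianPDF, sub_zero, add_sub_cancel, mul_comm]

lemma lintegral_complexGaussianPDF (m : ℂ) {v : ℝ≥0} (hv : v ≠ 0) :
    ∫⁻ z, ENNReal.ofReal (complexGaussianPDF m v z) = 1 := by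
  simpa using (lintegral_complexGaussian_add_left m hv measurable_const (F := 1)).symm

lemma memLp_norm_sq_complexGaussian (v : ℝ≥0) :
    MemLp (fun z : ℂ => ‖z‖ ^ 2) 2 (complexGaussian v) := by
  have hsq : MemLp (fun x : ℝ => x ^ 2) 2 (gaussianReal 0 (v / 2)) := by
    have h4 : MemLp (id : ℝ → ℝ) 4 (gaussianReal 0 (v / 2)) :=
      memLp_id_gaussianReal' 4 (by simp)
    have h42 : (4 : ℝ≥0∞) / 2 = 2 := by
      rw [show (4 : ℝ≥0∞) = 2 * 2 by norm_num]
      exact ENNReal.mul_div_cancel_right (by simp) (by simp)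
    simpa [h42] using h4.norm_rpow_div 2
  rw [complexGaussian, memLp_map_measure_iff (by fun_prop) (by fun_prop)]
  refine ((hsq.comp_measurePreserving measurePreserving_fst).add
    (hsq.comp_measurePreserving measurePreserving_snd)).congr_norm (by fun_prop) ?_
  exact ae_of_all _ fun p => congrArg _ (norm_sq_add_mul_I p.1 p.2).symm

lemma integral_norm_sq_complexGaussian (v : ℝ≥0) :
    ∫ z, ‖z‖ ^ 2 ∂complexGaussian v = v := by
  have hi : Integrable (fun x : ℝ => x ^ 2) (gaussianReal 0 (v / 2)) :=
    (memLp_id_gaussianReal' 2 (by simp)).integrable_sq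
  have hm : ∫ x, x ^ 2 ∂gaussianReal 0 (v / 2) = v / 2 := by
    have h := variance_id_gaussianReal (μ := 0) (v := v / 2)
    rw [variance_eq_integral (by fun_prop)] at h
    simpa using h
  rw [complexGaussian, integral_map (by fun_prop) (by fun_prop)]
  simp_rw [norm_sq_add_mul_I]
  rw [integral_add (hi.comp_fst _) (hi.comp_snd _), integral_fun_fst (fun x : ℝ => x ^ 2),
    integral_fun_snd (fun x : ℝ => x ^ 2), hm]
  simp

lemma lintegral_norm_sq_complexGaussian (v : ℝ≥0) :
    ∫⁻ z, ENNReal.ofReal (‖z‖ ^ 2) ∂complexGaussian v = v := by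
  rw [← ofReal_integral_eq_lintegral_ofReal ((memLp_norm_sq_complexGaussian v).integrable
    (by simp)) (ae_of_all _ fun _ => by positivity), integral_norm_sq_complexGaussian,
    ENNReal.ofReal_coe_nnreal]

lemma complexGaussian_map_neg (v : ℝ≥0) :
    (complexGaussian v).map (fun z => -z) = complexGaussian v := by
  refine Measure.ext_of_charFun (funext fun t => ?_)
  have h := charFun_map_smul (μ := complexGaussian v) (-1) t
  simpa only [neg_smul, one_smul, charFun_complexGaussian, norm_neg] using h

/-! ### Mutual information across additive Gaussian noise -/

section Moments

lemma lintegral_norm_add_sq_complexGaussian (v : ℝ≥0) (w : ℂ) :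
    ∫⁻ z, ENNReal.ofReal (‖w + z‖ ^ 2) ∂complexGaussian v = ENNReal.ofReal (‖w‖ ^ 2) + v := by
  have hneg : ∫⁻ z, ENNReal.ofReal (‖w - z‖ ^ 2) ∂complexGaussian v =
      ∫⁻ z, ENNReal.ofReal (‖w + z‖ ^ 2) ∂complexGaussian v := by
    conv_rhs => rw [← complexGaussian_map_neg, lintegral_map (by fun_prop) (by fun_prop)]
    simp only [sub_eq_add_neg]
  have hparallelogram : ∀ z : ℂ, ENNReal.ofReal (‖w + z‖ ^ 2) + ENNReal.ofReal (‖w - z‖ ^ 2) =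
      2 * (ENNReal.ofReal (‖w‖ ^ 2) + ENNReal.ofReal (‖z‖ ^ 2)) := by
    intro z
    rw [← ENNReal.ofReal_add (by positivity) (by positivity),
      ← ENNReal.ofReal_add (by positivity) (by positivity),
      ← ENNReal.ofReal_ofNat 2, ← ENNReal.ofReal_mul (by norm_num)]
    congr 1
    linarith [parallelogram_law_with_norm ℝ w z]
  have hsum := lintegral_congr (μ := complexGaussian v) hparallelogram
  rw [lintegral_add_left (by fun_prop), hneg, ← two_mul, lintegral_const_mul _ (by fun_prop),
    lintegral_add_left (by fun_prop), lintegral_norm_sq_complexGaussian, lintegral_const,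
    measure_univ, mul_one] at hsum
  exact (ENNReal.mul_right_inj (by simp) (by simp)).1 hsum

variable {Ω : Type*} [MeasurableSpace Ω] {μ : Measure Ω}

lemma integrable_norm_sq_of_lintegral_le {W : Ω → ℂ} (hW : Measurable W) {S : ℝ≥0}
    (hS : ∫⁻ ω, ENNReal.ofReal (‖W ω‖ ^ 2) ∂μ ≤ S) : Integrable (fun ω => ‖W ω‖ ^ 2) μ := by
  refine ⟨by fun_prop, ?_⟩
  rw [hasFiniteIntegral_iff_ofReal (ae_of_all _ fun _ => by positivity)]
  exact hS.trans_lt ENNReal.coe_lt_top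

lemma integral_norm_sq_le_of_lintegral_le {W : Ω → ℂ} (hW : Measurable W) {S : ℝ≥0}
    (hS : ∫⁻ ω, ENNReal.ofReal (‖W ω‖ ^ 2) ∂μ ≤ S) : ∫ ω, ‖W ω‖ ^ 2 ∂μ ≤ S := by
  rw [integral_eq_lintegral_of_nonneg_ae (ae_of_all _ fun _ => by positivity) (by fun_prop)]
  exact ENNReal.toReal_le_coe_of_le_coe hS

lemma lintegral_norm_add_noise_sq [IsProbabilityMeasure μ] {W Z : Ω → ℂ} (hW : Measurable W)
    (hZ : Measurable Z) (hind : IndepFun W Z μ) (hlaw : μ.map Z = stdComplexGaussian) :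
    ∫⁻ ω, ENNReal.ofReal (‖W ω + Z ω‖ ^ 2) ∂μ = ∫⁻ ω, ENNReal.ofReal (‖W ω‖ ^ 2) ∂μ + 1 := by
  have : IsProbabilityMeasure (μ.map W) := Measure.isProbabilityMeasure_map hW.aemeasurable
  calc ∫⁻ ω, ENNReal.ofReal (‖W ω + Z ω‖ ^ 2) ∂μ
      = ∫⁻ q, ENNReal.ofReal (‖q.1 + q.2‖ ^ 2) ∂μ.map (fun ω => (W ω, Z ω)) := by
        rw [lintegral_map (by fun_prop) (by fun_prop)]
    _ = ∫⁻ w, (ENNReal.ofReal (‖w‖ ^ 2) + 1) ∂μ.map W := by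
        rw [(indepFun_iff_map_prod_eq_prod_map_map (by fun_prop) (by fun_prop)).1 hind,
          lintegral_prod _ (by fun_prop), hlaw, ← complexGaussian_one]
        simp only [lintegral_norm_add_sq_complexGaussian, ENNReal.coe_one]
    _ = ∫⁻ ω, ENNReal.ofReal (‖W ω‖ ^ 2) ∂μ + 1 := by
        rw [lintegral_add_right _ measurable_const, lintegral_one, measure_univ,
          lintegral_map (by fun_prop) hW]

lemma integrable_logRatio {Z D : Ω → ℂ} [IsFiniteMeasure μ] (v : ℝ≥0) (hZ : Measurable Z)
    (hD : Measurable D) (hZ2 : ∫⁻ ω, ENNReal.ofReal (‖Z ω‖ ^ 2) ∂μ = 1)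
    (hD2 : ∫⁻ ω, ENNReal.ofReal (‖D ω‖ ^ 2) ∂μ ≤ v) :
    Integrable (fun ω => Real.log v - ‖Z ω‖ ^ 2 + ‖D ω‖ ^ 2 / v) μ :=
  ((integrable_const _).sub (integrable_norm_sq_of_lintegral_le hZ (S := 1) hZ2.le)).add
    ((integrable_norm_sq_of_lintegral_le hD hD2).div_const _)

lemma integral_logRatio_le {Z D : Ω → ℂ} [IsProbabilityMeasure μ] (v : ℝ≥0)
    (hZ : Measurable Z) (hD : Measurable D) (hZ2 : ∫⁻ ω, ENNReal.ofReal (‖Z ω‖ ^ 2) ∂μ = 1)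
    (hD2 : ∫⁻ ω, ENNReal.ofReal (‖D ω‖ ^ 2) ∂μ ≤ v) :
    ∫ ω, (Real.log v - ‖Z ω‖ ^ 2 + ‖D ω‖ ^ 2 / v) ∂μ ≤ Real.log v := by
  have hiZ := integrable_norm_sq_of_lintegral_le hZ (S := 1) hZ2.le
  have hiD := integrable_norm_sq_of_lintegral_le hD hD2
  have hZ1 : ∫ ω, ‖Z ω‖ ^ 2 ∂μ = 1 := by
    rw [integral_eq_lintegral_of_nonneg_ae (ae_of_all _ fun _ => by positivity) (by fun_prop), hZ2,
      ENNReal.toReal_one]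
  have hD1 : (∫ ω, ‖D ω‖ ^ 2 ∂μ) / v ≤ 1 :=
    div_le_one_of_le₀ (integral_norm_sq_le_of_lintegral_le hD hD2) v.coe_nonneg
  rw [integral_add (f := fun ω => Real.log v - ‖Z ω‖ ^ 2) ((integrable_const _).sub hiZ)
    (hiD.div_const _), integral_sub (integrable_const _) hiZ, integral_div, hZ1, integral_const,
    probReal_univ, one_smul]
  linarith

end Moments

section Divergence

variable {Ω α β γ : Type*} [MeasurableSpace Ω] [MeasurableSpace α] [MeasurableSpace β]
  [MeasurableSpace γ]

lemma klDiv_eq_integral_of_eq_withDensity_exp {μ ν : Measure α} [IsProbabilityMeasure μ]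
    [IsProbabilityMeasure ν] {l : α → ℝ} (hl : Measurable l)
    (hμ : μ = ν.withDensity (fun x => ENNReal.ofReal (Real.exp (l x)))) (h_int : Integrable l μ) :
    InformationTheory.klDiv μ ν = ENNReal.ofReal (∫ x, l x ∂μ) := by
  have hac : μ ≪ ν := hμ ▸ withDensity_absolutelyContinuous _ _
  have hllr : llr μ ν =ᵐ[μ] l := by
    have hrn := Measure.rnDeriv_withDensity ν
      (f := fun x => ENNReal.ofReal (Real.exp (l x))) (by fun_prop)
    rw [← hμ] at hrn
    refine hac.ae_eq ?_
    filter_upwards [hrn] with x hx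
    rw [llr, hx, ENNReal.toReal_ofReal (Real.exp_nonneg _), Real.log_exp]
  rw [InformationTheory.klDiv_of_ac_of_integrable hac ((integrable_congr hllr).2 h_int),
    integral_congr_ae hllr]
  simp

lemma klDiv_map_measurableEquiv {μ ν : Measure α} [IsFiniteMeasure μ] [IsFiniteMeasure ν]
    (e : α ≃ᵐ β) :
    InformationTheory.klDiv (μ.map e) (ν.map e) = InformationTheory.klDiv μ ν := by
  refine le_antisymm (InformationTheory.klDiv_map_le _ _ e.measurable) ?_
  have h := InformationTheory.klDiv_map_le (μ.map e) (ν.map e) e.symm.measurable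
  simpa [Measure.map_map e.symm.measurable e.measurable] using h

lemma compProd_prod_map_prodAssoc_symm (P : Measure γ) [SFinite P] (κ : Kernel γ α)
    [IsSFiniteKernel κ] (η : Kernel γ β) [IsSFiniteKernel η] :
    (P ⊗ₘ (κ ×ₖ η)).map MeasurableEquiv.prodAssoc.symm = (P ⊗ₘ κ) ⊗ₘ (η.prodMkRight α) := by
  refine Measure.ext_of_lintegral _ fun F hF => ?_
  rw [lintegral_map hF (by fun_prop), Measure.lintegral_compProd (by fun_prop),
    Measure.lintegral_compProd hF,
    Measure.lintegral_compProd (Measurable.lintegral_kernel_prod_right' hF)]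
  refine lintegral_congr fun c => ?_
  rw [Kernel.lintegral_prod _ _ _ (by fun_prop)]
  rfl

/-- By the chain rule, `P_{A|C}` minimizes `Q ↦ D(P_{CAB} ‖ P_C Q P_{B|C})`. -/
lemma klDiv_condDistrib_le [StandardBorelSpace α] [Nonempty α] [StandardBorelSpace β] [Nonempty β]
    {A : Ω → α} {B : Ω → β} {C : Ω → γ} (hA : Measurable A) (hB : Measurable B)
    (hC : Measurable C) (μ : Measure Ω) [IsProbabilityMeasure μ] (Q : Kernel γ α)
    [IsMarkovKernel Q] :
    InformationTheory.klDiv (μ.map (fun ω => (C ω, A ω, B ω)))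
        ((μ.map C) ⊗ₘ (condDistrib A C μ ×ₖ condDistrib B C μ)) ≤
      InformationTheory.klDiv (μ.map (fun ω => (C ω, A ω, B ω)))
        ((μ.map C) ⊗ₘ (Q ×ₖ condDistrib B C μ)) := by
  have : IsProbabilityMeasure (μ.map C) := Measure.isProbabilityMeasure_map hC.aemeasurable
  have : IsProbabilityMeasure (μ.map (fun ω => (C ω, A ω))) :=
    Measure.isProbabilityMeasure_map (by fun_prop)
  have : IsProbabilityMeasure (μ.map (fun ω => (C ω, A ω, B ω))) :=
    Measure.isProbabilityMeasure_map (by fun_prop)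
  have hjoint : (μ.map (fun ω => (C ω, A ω, B ω))).map MeasurableEquiv.prodAssoc.symm =
      μ.map (fun ω => (C ω, A ω)) ⊗ₘ condDistrib B (fun ω => (C ω, A ω)) μ := by
    rw [compProd_map_condDistrib hB.aemeasurable, Measure.map_map (by fun_prop) (by fun_prop)]
    rfl
  rw [← klDiv_map_measurableEquiv MeasurableEquiv.prodAssoc.symm,
    ← klDiv_map_measurableEquiv (ν := (μ.map C) ⊗ₘ (Q ×ₖ condDistrib B C μ))
      MeasurableEquiv.prodAssoc.symm,
    compProd_prod_map_prodAssoc_symm, compProd_prod_map_prodAssoc_symm,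
    compProd_map_condDistrib hA.aemeasurable, hjoint,
    InformationTheory.klDiv_compProd_eq_add (ν := (μ.map C) ⊗ₘ Q)]
  exact le_add_self

lemma condDistrib_unit_apply [StandardBorelSpace α] [Nonempty α] {A : Ω → α} (hA : Measurable A)
    {μ : Measure Ω} [IsProbabilityMeasure μ] :
    condDistrib A (fun _ => ()) μ () = μ.map A := by
  have h := congrArg (Measure.map Prod.snd)
    (compProd_map_condDistrib (X := fun _ : Ω => ()) (μ := μ) hA.aemeasurable)
  rw [Measure.map_map (by fun_prop) (by fun_prop), ← Measure.snd, Measure.snd_compProd,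
    Measure.map_const, measure_univ, one_smul, Measure.dirac_bind (by fun_prop)] at h
  exact h

lemma mutualInfo_le_condMutualInfo_unit [StandardBorelSpace α] [Nonempty α]
    [StandardBorelSpace β] [Nonempty β] {A : Ω → α} {B : Ω → β} (hA : Measurable A)
    (hB : Measurable B) (μ : Measure Ω) [IsProbabilityMeasure μ] :
    mutualInfo A B μ ≤ condMutualInfo A B (fun _ => ()) μ := by
  have : IsProbabilityMeasure (μ.map (fun ω => ((), A ω, B ω))) :=
    Measure.isProbabilityMeasure_map (by fun_prop)
  have : IsProbabilityMeasure (μ.map (fun _ : Ω => ())) :=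
    Measure.isProbabilityMeasure_map (by fun_prop)
  unfold mutualInfo condMutualInfo
  refine ENNReal.div_le_div_right ?_ _
  convert InformationTheory.klDiv_map_le (μ.map (fun ω => ((), A ω, B ω)))
    (μ.map (fun _ => ()) ⊗ₘ (condDistrib A (fun _ => ()) μ ×ₖ condDistrib B (fun _ => ()) μ))
    measurable_snd using 2
  · rw [Measure.map_map (by fun_prop) (by fun_prop)]
    rfl
  · rw [← Measure.snd, Measure.snd_compProd, Measure.map_const, measure_univ, one_smul,
      Measure.dirac_bind (by fun_prop), Kernel.prod_apply, condDistrib_unit_apply hA,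
      condDistrib_unit_apply hB]

end Divergence

section AdditiveNoise

variable {Ω β γ : Type*} [MeasurableSpace Ω] [MeasurableSpace β] [MeasurableSpace γ]

/-- The kernel sending `c` to the proper complex Gaussian law of mean `m c` and variance `v`, given
by its density; it is a Markov kernel when `v ≠ 0`. -/
def gaussianKernel (m : γ → ℂ) (v : ℝ≥0) : Kernel γ ℂ :=
  Kernel.withDensity (Kernel.const γ volume)
    (fun c y => ENNReal.ofReal (complexGaussianPDF (m c) v y))

lemma isMarkovKernel_gaussianKernel {m : γ → ℂ} (hm : Measurable m) {v : ℝ≥0} (hv : v ≠ 0) :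
    IsMarkovKernel (gaussianKernel m v) := by
  refine ⟨fun c => ⟨?_⟩⟩
  rw [gaussianKernel, Kernel.withDensity_apply' _ (by fun_prop), setLIntegral_univ,
    Kernel.const_apply, lintegral_complexGaussianPDF _ hv]

lemma lintegral_gaussianKernel {m : γ → ℂ} (hm : Measurable m) (v : ℝ≥0) (c : γ)
    {F : ℂ → ℝ≥0∞} (hF : Measurable F) :
    ∫⁻ y, F y ∂gaussianKernel m v c =
      ∫⁻ y, ENNReal.ofReal (complexGaussianPDF (m c) v y) * F y := by
  rw [gaussianKernel, Kernel.lintegral_withDensity _ (by fun_prop) _ hF, Kernel.const_apply]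

lemma complexGaussianPDF_mul_exp (s m y : ℂ) {v : ℝ≥0} (hv : v ≠ 0) :
    complexGaussianPDF m v y * Real.exp (Real.log v - ‖y - s‖ ^ 2 + ‖y - m‖ ^ 2 / v) =
      complexGaussianPDF s (1 : ℝ≥0) y := by
  have hv0 : (0 : ℝ) < v := by positivity
  have hexp : Real.exp (-‖y - m‖ ^ 2 / v) *
      Real.exp (Real.log v - ‖y - s‖ ^ 2 + ‖y - m‖ ^ 2 / v) = v * Real.exp (-‖y - s‖ ^ 2) := by
    rw [← Real.exp_add, show -‖y - m‖ ^ 2 / v + (Real.log v - ‖y - s‖ ^ 2 + ‖y - m‖ ^ 2 / v) =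
      Real.log v + -‖y - s‖ ^ 2 by ring, Real.exp_add, Real.exp_log hv0]
  rw [complexGaussianPDF, complexGaussianPDF, mul_assoc, hexp, NNReal.coe_one, div_one]
  field_simp

/-- The logarithm, at `(c, y, b)`, of the density of the law of `(C, f (C, B) + Z, B)`, where `Z` is
standard complex Gaussian noise, with respect to the law in which the output given `C` has been
replaced by a Gaussian of mean `m C` and variance `v`, independent of `B`. -/
def gaussianLogRatio (f : γ × β → ℂ) (m : γ → ℂ) (v : ℝ≥0) (p : γ × ℂ × β) : ℝ :=
  Real.log v - ‖p.2.1 - f (p.1, p.2.2)‖ ^ 2 + ‖p.2.1 - m p.1‖ ^ 2 / v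

lemma measurable_gaussianLogRatio {f : γ × β → ℂ} {m : γ → ℂ} (hf : Measurable f)
    (hm : Measurable m) (v : ℝ≥0) : Measurable (gaussianLogRatio f m v) := by
  unfold gaussianLogRatio
  fun_prop

variable [StandardBorelSpace β] [Nonempty β] {μ : Measure Ω} [IsProbabilityMeasure μ] {B : Ω → β}
  {C : Ω → γ} {Z : Ω → ℂ} {f : γ × β → ℂ} {m : γ → ℂ}

lemma lintegral_map_add_noise (hB : Measurable B) (hC : Measurable C) (hZ : Measurable Z)
    (hf : Measurable f) (hind : IndepFun (fun ω => (C ω, B ω)) Z μ)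
    (hlaw : μ.map Z = stdComplexGaussian) {F : γ × ℂ × β → ℝ≥0∞} (hF : Measurable F) :
    ∫⁻ p, F p ∂μ.map (fun ω => (C ω, f (C ω, B ω) + Z ω, B ω)) =
      ∫⁻ c, ∫⁻ b, ∫⁻ y, F (c, y, b) *
        ENNReal.ofReal (complexGaussianPDF (f (c, b)) (1 : ℝ≥0) y)
        ∂volume ∂condDistrib B C μ c ∂μ.map C := by
  have hjoint : μ.map (fun ω => (C ω, f (C ω, B ω) + Z ω, B ω)) =
      ((μ.map (fun ω => (C ω, B ω))).prod stdComplexGaussian).map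
        (fun q => (q.1.1, f q.1 + q.2, q.1.2)) := by
    rw [← hlaw, ← (indepFun_iff_map_prod_eq_prod_map_map (by fun_prop) (by fun_prop)).1 hind,
      Measure.map_map (by fun_prop) (by fun_prop)]
    rfl
  rw [hjoint, lintegral_map hF (by fun_prop), lintegral_prod _ (by fun_prop),
    ← compProd_map_condDistrib hB.aemeasurable, Measure.lintegral_compProd]
  · refine lintegral_congr fun c => lintegral_congr fun b => ?_
    exact lintegral_complexGaussian_add_left (f (c, b)) one_ne_zero (F := fun y => F (c, y, b))
      (by fun_prop)
  · exact Measurable.lintegral_prod_right' (f := fun q : (γ × β) × ℂ =>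
      F (q.1.1, f q.1 + q.2, q.1.2)) (by fun_prop)

lemma map_add_noise_eq_withDensity (hB : Measurable B) (hC : Measurable C) (hZ : Measurable Z)
    (hf : Measurable f) (hind : IndepFun (fun ω => (C ω, B ω)) Z μ)
    (hlaw : μ.map Z = stdComplexGaussian) (hm : Measurable m) {v : ℝ≥0} (hv : v ≠ 0) :
    μ.map (fun ω => (C ω, f (C ω, B ω) + Z ω, B ω)) =
      ((μ.map C) ⊗ₘ (gaussianKernel m v ×ₖ condDistrib B C μ)).withDensity
        (fun p => ENNReal.ofReal (Real.exp (gaussianLogRatio f m v p))) := by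
  have := isMarkovKernel_gaussianKernel hm hv
  have : IsProbabilityMeasure (μ.map C) := Measure.isProbabilityMeasure_map hC.aemeasurable
  refine Measure.ext_of_lintegral _ fun F hF => ?_
  set r : γ × ℂ × β → ℝ≥0∞ := fun p => ENNReal.ofReal (Real.exp (gaussianLogRatio f m v p))
    with hr
  have hrm : Measurable r := (measurable_gaussianLogRatio hf hm v).exp.ennreal_ofReal
  rw [lintegral_map_add_noise hB hC hZ hf hind hlaw hF,
    lintegral_withDensity_eq_lintegral_mul _ hrm hF, Measure.lintegral_compProd (by fun_prop)]
  refine lintegral_congr fun c => ?_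
  rw [Kernel.lintegral_prod _ _ _ (by fun_prop), lintegral_gaussianKernel hm v c
    (Measurable.lintegral_prod_right' (f := fun q : ℂ × β => (r * F) (c, q)) (by fun_prop)),
    lintegral_lintegral_swap (by fun_prop)]
  refine lintegral_congr fun y => ?_
  rw [← lintegral_const_mul _ (by fun_prop)]
  refine lintegral_congr fun b => ?_
  rw [← complexGaussianPDF_mul_exp (f (c, b)) (m c) y hv,
    ENNReal.ofReal_mul (complexGaussianPDF_pos _ (by positivity) _).le, Pi.mul_apply, hr]
  simp only [gaussianLogRatio]
  ring

/-- A Gaussian has the largest entropy among outputs of given power around the estimate `m C`; so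
the output given `C` is compared with a Gaussian of mean `m C` and variance `1 + S`. -/
lemma condMutualInfo_add_noise_le (hB : Measurable B) (hC : Measurable C) (hZ : Measurable Z)
    (hf : Measurable f) (hind : IndepFun (fun ω => (C ω, B ω)) Z μ)
    (hlaw : μ.map Z = stdComplexGaussian) (hm : Measurable m) {S : ℝ≥0}
    (hS : ∫⁻ ω, ENNReal.ofReal (‖f (C ω, B ω) - m (C ω)‖ ^ 2) ∂μ ≤ S) :
    condMutualInfo (fun ω => f (C ω, B ω) + Z ω) B C μ ≤ ENNReal.ofReal (Real.logb 2 (1 + S)) := by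
  have hv : 1 + S ≠ 0 := by positivity
  have := isMarkovKernel_gaussianKernel hm hv
  have : IsProbabilityMeasure (μ.map C) := Measure.isProbabilityMeasure_map hC.aemeasurable
  have : IsProbabilityMeasure (μ.map (fun ω => (C ω, f (C ω, B ω) + Z ω, B ω))) :=
    Measure.isProbabilityMeasure_map (by fun_prop)
  have hlm := measurable_gaussianLogRatio hf hm (1 + S)
  have hZ2 : ∫⁻ ω, ENNReal.ofReal (‖Z ω‖ ^ 2) ∂μ = 1 := by
    rw [← lintegral_map (f := fun z => ENNReal.ofReal (‖z‖ ^ 2)) (by fun_prop) hZ, hlaw,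
      ← complexGaussian_one, lintegral_norm_sq_complexGaussian, ENNReal.coe_one]
  have hD : Measurable (fun ω => f (C ω, B ω) - m (C ω) + Z ω) := by fun_prop
  have hD2 : ∫⁻ ω, ENNReal.ofReal (‖f (C ω, B ω) - m (C ω) + Z ω‖ ^ 2) ∂μ ≤ (1 + S : ℝ≥0) := by
    have hW := hind.comp (φ := fun q => f q - m q.1) (by fun_prop) measurable_id
    rw [lintegral_norm_add_noise_sq (W := fun ω => f (C ω, B ω) - m (C ω)) (by fun_prop) hZ hW
      hlaw, add_comm, ENNReal.coe_add, ENNReal.coe_one]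
    gcongr
  have hl : (fun ω => gaussianLogRatio f m (1 + S) (C ω, f (C ω, B ω) + Z ω, B ω)) = fun ω =>
      Real.log (1 + S : ℝ≥0) - ‖Z ω‖ ^ 2 +
        ‖f (C ω, B ω) - m (C ω) + Z ω‖ ^ 2 / (1 + S : ℝ≥0) := by
    simp only [gaussianLogRatio, add_sub_cancel_left, sub_add_eq_add_sub]
  have hil : Integrable (gaussianLogRatio f m (1 + S))
      (μ.map (fun ω => (C ω, f (C ω, B ω) + Z ω, B ω))) := by
    rw [integrable_map_measure hlm.aestronglyMeasurable (by fun_prop)]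
    exact (integrable_logRatio _ hZ hD hZ2 hD2).congr (ae_of_all _ (congrFun hl.symm))
  have hle := klDiv_condDistrib_le (A := fun ω => f (C ω, B ω) + Z ω) (by fun_prop) hB hC μ
    (gaussianKernel m (1 + S))
  rw [klDiv_eq_integral_of_eq_withDensity_exp hlm
    (map_add_noise_eq_withDensity hB hC hZ hf hind hlaw hm hv) hil,
    integral_map (by fun_prop) hlm.aestronglyMeasurable, hl] at hle
  rw [condMutualInfo, Real.logb, ENNReal.ofReal_div_of_pos (Real.log_pos one_lt_two)]
  refine ENNReal.div_le_div_right (hle.trans (ENNReal.ofReal_le_ofReal ?_)) _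
  simpa using integral_logRatio_le _ hZ hD hZ2 hD2

end AdditiveNoise

/-! ### The outer bound -/

section OuterBound

lemma sq_norm_sum_mul_le {ι 𝕜 : Type*} [NormedField 𝕜] (s : Finset ι) (a x : ι → 𝕜) :
    ‖∑ i ∈ s, a i * x i‖ ^ 2 ≤ (∑ i ∈ s, ‖a i‖) * ∑ i ∈ s, ‖a i‖ * ‖x i‖ ^ 2 :=
  calc ‖∑ i ∈ s, a i * x i‖ ^ 2 ≤ (∑ i ∈ s, ‖a i‖ * ‖x i‖) ^ 2 := by
        gcongr
        simpa only [norm_mul] using norm_sum_le s fun i => a i * x i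
    _ ≤ _ := s.sum_sq_le_sum_mul_sum_of_sq_le_mul (fun _ _ => by positivity)
        (fun _ _ => by positivity) fun _ _ => le_of_eq (by ring)

lemma lintegral_norm_sq_sum_mul_le {ι 𝕜 : Type*} [Fintype ι] [NormedField 𝕜] [MeasurableSpace 𝕜]
    [BorelSpace 𝕜] [SecondCountableTopology 𝕜] {P : Measure (ι → 𝕜)}
    (hP : ∀ i, ∫⁻ x, ENNReal.ofReal (‖x i‖ ^ 2) ∂P ≤ 1) (a : ι → 𝕜) :
    ∫⁻ x, ENNReal.ofReal (‖∑ i, a i * x i‖ ^ 2) ∂P ≤ ((∑ i, ‖a i‖₊) ^ 2 : ℝ≥0) := by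
  calc ∫⁻ x, ENNReal.ofReal (‖∑ i, a i * x i‖ ^ 2) ∂P
      ≤ ∫⁻ x, (∑ i, ‖a i‖₊ : ℝ≥0) * ∑ i, ‖a i‖₊ * ENNReal.ofReal (‖x i‖ ^ 2) ∂P := by
        refine lintegral_mono fun x => ?_
        have h := ENNReal.ofReal_le_ofReal (sq_norm_sum_mul_le Finset.univ a x)
        rw [ENNReal.ofReal_mul (by positivity),
          ENNReal.ofReal_sum_of_nonneg fun _ _ => by positivity,
          ENNReal.ofReal_sum_of_nonneg fun _ _ => by positivity] at h
        simpa only [ENNReal.ofReal_mul (norm_nonneg _), ofReal_norm, enorm_eq_nnnorm,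
          ENNReal.ofNNReal_finsetSum] using h
    _ = (∑ i, ‖a i‖₊ : ℝ≥0) * ∑ i, ‖a i‖₊ * ∫⁻ x, ENNReal.ofReal (‖x i‖ ^ 2) ∂P := by
        rw [lintegral_const_mul _ (by fun_prop), lintegral_finsetSum _ (by fun_prop)]
        congr 1
        exact Finset.sum_congr rfl fun i _ => lintegral_const_mul _ (by fun_prop)
    _ ≤ (∑ i, ‖a i‖₊ : ℝ≥0) * ∑ i, (‖a i‖₊ * 1 : ℝ≥0∞) := by
        gcongr with i
        exact hP i
    _ = ((∑ i, ‖a i‖₊) ^ 2 : ℝ≥0) := by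
        simp only [mul_one, sq, ENNReal.coe_mul, ENNReal.ofNNReal_finsetSum]

variable (P : Measure (Fin 3 → ℂ)) [IsProbabilityMeasure P]

lemma measurePreserving_noise (k : Fin 3) :
    MeasurePreserving (fun ω => ω.2 k) (inputNoiseLaw P) stdComplexGaussian :=
  (measurePreserving_eval (fun _ : Fin 3 => stdComplexGaussian) k).comp measurePreserving_snd

lemma indepFun_noise (k : Fin 3) :
    IndepFun (fun ω => (ω.1, fun j => ω.2 (k.succAbove j))) (fun ω => ω.2 k) (inputNoiseLaw P) := by
  have hsplit : MeasurePreserving (fun ω => ((ω.1, fun j => ω.2 (k.succAbove j)), ω.2 k))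
      (inputNoiseLaw P)
      ((P.prod (Measure.pi fun _ : Fin 2 => stdComplexGaussian)).prod stdComplexGaussian) :=
    ((measurePreserving_prodAssoc P (Measure.pi fun _ : Fin 2 => stdComplexGaussian)
      stdComplexGaussian).symm _).comp ((MeasurePreserving.id P).prod
        (Measure.measurePreserving_swap.comp
          (measurePreserving_piFinSuccAbove (fun _ : Fin 3 => stdComplexGaussian) k)))
  have hrest : MeasurePreserving (fun ω => (ω.1, fun j => ω.2 (k.succAbove j))) (inputNoiseLaw P)
      (P.prod (Measure.pi fun _ : Fin 2 => stdComplexGaussian)) :=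
    measurePreserving_fst.comp hsplit
  rw [indepFun_iff_map_prod_eq_prod_map_map (by fun_prop) (by fun_prop), hsplit.map_eq,
    (measurePreserving_noise P k).map_eq, hrest.map_eq]

lemma lintegral_norm_sq_noise (k : Fin 3) :
    ∫⁻ ω, ENNReal.ofReal (‖ω.2 k‖ ^ 2) ∂inputNoiseLaw P = 1 := by
  rw [(measurePreserving_noise P k).lintegral_comp (f := fun z => ENNReal.ofReal (‖z‖ ^ 2))
    (by fun_prop), ← complexGaussian_one, lintegral_norm_sq_complexGaussian, ENNReal.coe_one]

variable (H : Matrix (Fin 3) (Fin 3) ℂ)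

lemma condMutualInfo_outputY_le (l : Fin 3) {β γ : Type*} [MeasurableSpace β]
    [StandardBorelSpace β] [Nonempty β] [MeasurableSpace γ] {B : (Fin 3 → ℂ) × (Fin 3 → ℂ) → β}
    {C : (Fin 3 → ℂ) × (Fin 3 → ℂ) → γ} {g : (Fin 3 → ℂ) × (Fin 2 → ℂ) → γ × β} {f : γ × β → ℂ}
    {m : γ → ℂ} (hg : Measurable g) (hf : Measurable f) (hm : Measurable m)
    (hCB : ∀ ω, (C ω, B ω) = g (ω.1, fun j => ω.2 (l.succAbove j)))
    (hY : ∀ ω, outputY H l ω = f (C ω, B ω) + ω.2 l) {S : ℝ≥0}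
    (hS : ∫⁻ ω, ENNReal.ofReal (‖f (C ω, B ω) - m (C ω)‖ ^ 2) ∂inputNoiseLaw P ≤ S) :
    condMutualInfo (outputY H l) B C (inputNoiseLaw P) ≤ ENNReal.ofReal (Real.logb 2 (1 + S)) := by
  have hCBm : Measurable fun ω => (C ω, B ω) := by
    rw [funext hCB]
    fun_prop
  have hind : IndepFun (fun ω => (C ω, B ω)) (fun ω => ω.2 l) (inputNoiseLaw P) := by
    rw [funext hCB]
    exact (indepFun_noise P l).comp hg measurable_id
  rw [funext hY]
  exact condMutualInfo_add_noise_le hCBm.snd hCBm.fst (by fun_prop) hf hind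
    (measurePreserving_noise P l).map_eq hm hS

lemma mutualInfo_outputY_le (hP : ∀ i, ∫⁻ x, ENNReal.ofReal (‖x i‖ ^ 2) ∂P ≤ 1) (l : Fin 3) :
    mutualInfo (outputY H l) (fun ω => (inputX 0 ω, inputX 1 ω, inputX 2 ω)) (inputNoiseLaw P) ≤
      ENNReal.ofReal (Real.logb 2 (1 + (∑ i, ‖H l i‖) ^ 2)) := by
  have hpower : ∫⁻ ω, ENNReal.ofReal (‖H l 0 * inputX 0 ω + H l 1 * inputX 1 ω +
      H l 2 * inputX 2 ω - 0‖ ^ 2) ∂inputNoiseLaw P ≤ ((∑ i, ‖H l i‖₊) ^ 2 : ℝ≥0) := by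
    refine le_of_eq_of_le ?_ (lintegral_norm_sq_sum_mul_le hP (H l))
    rw [← (measurePreserving_fst (μ := P) (ν := Measure.pi fun _ : Fin 3 =>
      stdComplexGaussian)).lintegral_comp (by fun_prop)]
    simp only [Fin.sum_univ_three, inputX, sub_zero, inputNoiseLaw]
  have hle := condMutualInfo_outputY_le P H l (m := fun _ : Unit => 0)
    (B := fun ω => (inputX 0 ω, inputX 1 ω, inputX 2 ω)) (C := fun _ => ())
    (g := fun q => ((), q.1 0, q.1 1, q.1 2))
    (f := fun q => H l 0 * q.2.1 + H l 1 * q.2.2.1 + H l 2 * q.2.2.2)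
    (by fun_prop) (by fun_prop) (by fun_prop) (fun ω => rfl)
    (fun ω => by simp only [outputY, inputX, Fin.sum_univ_three]) hpower
  refine (mutualInfo_le_condMutualInfo_unit (by unfold outputY; fun_prop)
    (by unfold inputX; fun_prop) _).trans ?_
  simpa only [NNReal.coe_pow, NNReal.coe_sum, coe_nnnorm] using hle

/-- The receiver that sees the same signal through independent noise estimates it by `Y₁`. -/
lemma condMutualInfo_outputY_one_le (hrow : H 1 = H 0) :
    condMutualInfo (outputY H 1) (fun ω => (inputX 1 ω, inputX 2 ω))
      (fun ω => (inputX 0 ω, outputY H 0 ω)) (inputNoiseLaw P) ≤ 1 := by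
  have hle := condMutualInfo_outputY_le P H 1 (S := 1) (m := fun c : ℂ × ℂ => c.2)
    (g := fun q => ((q.1 0, ∑ i, H 0 i * q.1 i + q.2 0), q.1 1, q.1 2))
    (f := fun q => H 0 0 * q.1.1 + H 0 1 * q.2.1 + H 0 2 * q.2.2)
    (B := fun ω => (inputX 1 ω, inputX 2 ω)) (C := fun ω => (inputX 0 ω, outputY H 0 ω))
    (by fun_prop) (by fun_prop) (by fun_prop) (fun ω => rfl)
    (fun ω => by simp only [outputY, inputX, Fin.sum_univ_three, hrow]) ?_
  · refine hle.trans_eq ?_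
    norm_num
  · rw [ENNReal.coe_one, ← lintegral_norm_sq_noise P 0]
    simp only [outputY, inputX, Fin.sum_univ_three, sub_add_cancel_left, norm_neg, le_refl]

/-- Given `X₁, X₂`, receiver 1 sees `X₃` through the stronger gain, so rescaling its output
estimates the signal of receiver 3 within the noise power. -/
lemma condMutualInfo_outputY_two_le (hne : H 0 2 ≠ 0) (hle : ‖H 2 2‖ ≤ ‖H 0 2‖) :
    condMutualInfo (outputY H 2) (inputX 2)
      (fun ω => (inputX 0 ω, inputX 1 ω, outputY H 0 ω, outputY H 1 ω)) (inputNoiseLaw P) ≤ 1 := by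
  obtain ⟨r, hr, hr1⟩ : ∃ r, H 2 2 = r * H 0 2 ∧ ‖r‖ ≤ 1 :=
    ⟨H 2 2 / H 0 2, (div_mul_cancel₀ _ hne).symm, by
      rw [norm_div]
      exact div_le_one_of_le₀ hle (norm_nonneg _)⟩
  have hle := condMutualInfo_outputY_le P H 2 (S := 1)
    (m := fun c : ℂ × ℂ × ℂ × ℂ =>
      H 2 0 * c.1 + H 2 1 * c.2.1 + r * (c.2.2.1 - H 0 0 * c.1 - H 0 1 * c.2.1))
    (g := fun q =>
      ((q.1 0, q.1 1, ∑ i, H 0 i * q.1 i + q.2 0, ∑ i, H 1 i * q.1 i + q.2 1), q.1 2))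
    (f := fun q => H 2 0 * q.1.1 + H 2 1 * q.1.2.1 + H 2 2 * q.2) (B := inputX 2)
    (C := fun ω => (inputX 0 ω, inputX 1 ω, outputY H 0 ω, outputY H 1 ω))
    (by fun_prop) (by fun_prop) (by fun_prop) (fun ω => rfl)
    (fun ω => by simp only [outputY, inputX, Fin.sum_univ_three]) ?_
  · refine hle.trans_eq ?_
    norm_num
  · rw [ENNReal.coe_one, ← lintegral_norm_sq_noise P 0]
    refine lintegral_mono fun ω => ENNReal.ofReal_le_ofReal ?_
    have herror : H 2 0 * inputX 0 ω + H 2 1 * inputX 1 ω + H 2 2 * inputX 2 ω -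
        (H 2 0 * inputX 0 ω + H 2 1 * inputX 1 ω +
          r * (outputY H 0 ω - H 0 0 * inputX 0 ω - H 0 1 * inputX 1 ω)) = -(r * ω.2 0) := by
      simp only [outputY, inputX, Fin.sum_univ_three, hr]
      ring
    rw [herror, norm_neg, norm_mul, mul_pow]
    exact mul_le_of_le_one_left (by positivity) (pow_le_one₀ (norm_nonneg r) hr1)

end OuterBound

lemma cmsSumCapacityOuterBound_le {H : Matrix (Fin 3) (Fin 3) ℂ} (hrow : H 1 = H 0)
    (hne : H 0 2 ≠ 0) (hle : ‖H 2 2‖ ≤ ‖H 0 2‖) :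
    cmsSumCapacityOuterBound H ≤ ENNReal.ofReal (Real.logb 2 (1 + (∑ i, ‖H 0 i‖) ^ 2) + 2) := by
  refine iSup_le fun P => iSup_le fun _ => iSup_le fun hP => ?_
  have hlog : 0 ≤ Real.logb 2 (1 + (∑ i, ‖H 0 i‖) ^ 2) :=
    Real.logb_nonneg one_lt_two (le_add_of_nonneg_right (sq_nonneg _))
  rw [ENNReal.ofReal_add hlog two_pos.le, show ENNReal.ofReal 2 = 1 + 1 by norm_num, ← add_assoc]
  exact add_le_add (add_le_add (mutualInfo_outputY_le P H hP 0)
    (condMutualInfo_outputY_one_le P H hrow)) (condMutualInfo_outputY_two_le P H hne hle)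

/-! ### Blocks of independent Gaussian variables -/

section Blocks

variable {ι : Type*} [Fintype ι]

lemma pi_conv_pi {M : Type*} [AddMonoid M] [MeasurableSpace M] [MeasurableAdd₂ M]
    (μ ν : ι → Measure M) [∀ i, IsFiniteMeasure (μ i)] [∀ i, IsFiniteMeasure (ν i)] :
    Measure.pi μ ∗ Measure.pi ν = Measure.pi fun i => μ i ∗ ν i := by
  have hadd : MeasurePreserving (fun (p : ι → M × M) i => (p i).1 + (p i).2)
      (Measure.pi fun i => (μ i).prod (ν i)) (Measure.pi fun i => μ i ∗ ν i) :=
    measurePreserving_pi _ _ fun i => ⟨measurable_fst.add measurable_snd, rfl⟩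
  rw [← hadd.map_eq, Measure.conv,
    ← (measurePreserving_arrowProdEquivProdArrow M M ι μ ν).map_eq,
    Measure.map_map measurable_add (MeasurableEquiv.measurable _)]
  rfl

lemma lintegral_pi_prod_eval {α : ι → Type*} [∀ i, MeasurableSpace (α i)]
    (μ : ∀ i, Measure (α i)) [∀ i, IsProbabilityMeasure (μ i)] {f : ∀ i, α i → ℝ≥0∞}
    (hf : ∀ i, Measurable (f i)) :
    ∫⁻ x, ∏ i, f i (x i) ∂Measure.pi μ = ∏ i, ∫⁻ y, f i y ∂μ i := by
  rw [lintegral_prod_eq_prod_lintegral_of_indepFun _ (fun i (x : ∀ i, α i) => f i (x i))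
    (iIndepFun_pi fun i => (hf i).aemeasurable) fun i => (hf i).comp (measurable_pi_apply i)]
  exact Finset.prod_congr rfl fun i _ => (measurePreserving_eval μ i).lintegral_comp (hf i)

lemma pi_sum_nonneg_le_prod_lintegral_exp {α : ι → Type*} [∀ i, MeasurableSpace (α i)]
    (μ : ∀ i, Measure (α i)) [∀ i, IsProbabilityMeasure (μ i)] {g : ∀ i, α i → ℝ}
    (hg : ∀ i, Measurable (g i)) :
    Measure.pi μ {x | 0 ≤ ∑ i, g i (x i)} ≤
      ∏ i, ∫⁻ y, ENNReal.ofReal (Real.exp (g i y)) ∂μ i := by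
  rw [← lintegral_pi_prod_eval μ fun i => (hg i).exp.ennreal_ofReal]
  have hmeas : Measurable fun x : ∀ i, α i => ∏ i, ENNReal.ofReal (Real.exp (g i (x i))) :=
    Finset.measurable_fun_prod _ fun i _ =>
      ((hg i).comp (measurable_pi_apply i)).exp.ennreal_ofReal
  refine meas_le_lintegral₀ hmeas.aemeasurable fun x hx => ?_
  rw [← ENNReal.ofReal_prod_of_nonneg fun _ _ => (Real.exp_pos _).le, ← Real.exp_sum]
  exact ENNReal.one_le_ofReal.2 (Real.one_le_exp hx)

lemma pi_sum_deviation_le {α : Type*} [MeasurableSpace α] (μ : Measure α) [IsProbabilityMeasure μ]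
    {f : α → ℝ} (hf : MemLp f 2 μ) {c : ℝ} (hc : 0 < c) :
    Measure.pi (fun _ : ι => μ) {x | c ≤ |∑ i, f (x i) - Fintype.card ι * μ[f]|} ≤
      ENNReal.ofReal (Fintype.card ι * Var[f; μ] / c ^ 2) := by
  have hmem : ∀ i, MemLp (fun x : ι → α => f (x i)) 2 (Measure.pi fun _ => μ) := fun i =>
    hf.comp_measurePreserving (measurePreserving_eval (fun _ => μ) i)
  have hmean : ∫ x, ∑ i, f (x i) ∂Measure.pi (fun _ : ι => μ) = Fintype.card ι * μ[f] := by
    rw [integral_finsetSum _ fun i _ => (hmem i).integrable one_le_two,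
      Finset.sum_congr rfl fun i _ => integral_comp_eval (μ := fun _ : ι => μ) hf.1,
      Finset.sum_const, Finset.card_univ, nsmul_eq_mul]
  have hvar : Var[fun x => ∑ i, f (x i); Measure.pi fun _ : ι => μ] =
      Fintype.card ι * Var[f; μ] := by
    have hsum := variance_sum_pi (μ := fun _ : ι => μ) (X := fun _ => f) fun _ => hf
    rw [Finset.sum_const, Finset.card_univ, nsmul_eq_mul] at hsum
    rw [← hsum]
    congr 1 with x
    rw [Finset.sum_apply]
  simpa only [hmean, hvar] using
    meas_ge_le_variance_div_sq (memLp_finsetSum Finset.univ fun i _ => hmem i) hc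

lemma tendsto_pi_sum_deviation {α : Type*} [MeasurableSpace α] (μ : Measure α)
    [IsProbabilityMeasure μ] {f : α → ℝ} (hf : MemLp f 2 μ) {ε : ℝ} (hε : 0 < ε) :
    Tendsto (fun n : ℕ => Measure.pi (fun _ : Fin n => μ)
      {x | n * ε ≤ |∑ t, f (x t) - n * μ[f]|}) atTop (𝓝 0) := by
  have hlim : Tendsto (fun n : ℕ => ENNReal.ofReal (Var[f; μ] / ε ^ 2 / n)) atTop (𝓝 0) := by
    simpa only [ENNReal.ofReal_zero] using
      ENNReal.tendsto_ofReal (tendsto_const_div_atTop_nhds_zero_nat (Var[f; μ] / ε ^ 2))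
  refine tendsto_of_tendsto_of_tendsto_of_le_of_le' tendsto_const_nhds hlim
    (Eventually.of_forall fun _ => zero_le) ?_
  filter_upwards [eventually_gt_atTop 0] with n hn
  have hn' : (0 : ℝ) < n := Nat.cast_pos.2 hn
  have hle := pi_sum_deviation_le (ι := Fin n) μ hf (mul_pos hn' hε)
  rw [Fintype.card_fin] at hle
  refine hle.trans_eq (congrArg _ ?_)
  field_simp

/-- A block of `n` independent proper complex Gaussian variables of variance `v`. -/
def gaussianBlock (n : ℕ) (v : ℝ≥0) : Measure (Fin n → ℂ) := Measure.pi fun _ => complexGaussian v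

instance (n : ℕ) (v : ℝ≥0) : IsProbabilityMeasure (gaussianBlock n v) := by
  unfold gaussianBlock; infer_instance

instance (n : ℕ) : IsProbabilityMeasure (blockNoise n) := by
  unfold blockNoise; infer_instance

lemma gaussianBlock_one (n : ℕ) : gaussianBlock n 1 = blockNoise n := rfl

lemma gaussianBlock_conv_gaussianBlock (n : ℕ) (v w : ℝ≥0) :
    gaussianBlock n v ∗ gaussianBlock n w = gaussianBlock n (v + w) := by
  simp only [gaussianBlock, pi_conv_pi, complexGaussian_conv_complexGaussian]

lemma tendsto_gaussianBlock_lt_energy {v : ℝ≥0} {p : ℝ} (hp : v < p) :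
    Tendsto (fun n : ℕ => gaussianBlock n v {x | n * p < ∑ t, ‖x t‖ ^ 2}) atTop (𝓝 0) := by
  refine tendsto_of_tendsto_of_tendsto_of_le_of_le tendsto_const_nhds
    (tendsto_pi_sum_deviation _ (memLp_norm_sq_complexGaussian v) (sub_pos.2 hp))
    (fun _ => zero_le) fun n => measure_mono fun x hx => ?_
  rw [Set.mem_ofPred_eq, integral_norm_sq_complexGaussian]
  exact le_abs.2 (Or.inl (by linarith [Set.mem_ofPred_eq ▸ hx, mul_sub (n : ℝ) p v]))

lemma tendsto_gaussianBlock_energy_lt {v : ℝ≥0} {p : ℝ} (hp : p < v) :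
    Tendsto (fun n : ℕ => gaussianBlock n v {x | ∑ t, ‖x t‖ ^ 2 < n * p}) atTop (𝓝 0) := by
  refine tendsto_of_tendsto_of_tendsto_of_le_of_le tendsto_const_nhds
    (tendsto_pi_sum_deviation _ (memLp_norm_sq_complexGaussian v) (sub_pos.2 hp))
    (fun _ => zero_le) fun n => measure_mono fun x hx => ?_
  rw [Set.mem_ofPred_eq, integral_norm_sq_complexGaussian]
  exact le_abs.2 (Or.inr (by linarith [Set.mem_ofPred_eq ▸ hx, mul_sub (n : ℝ) v p]))

lemma lintegral_exp_norm_sq_div_sub (u : ℂ) {v : ℝ≥0} (hv : v ≠ 0) (c : ℝ) :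
    ∫⁻ y, ENNReal.ofReal (Real.exp (c + ‖y‖ ^ 2 / v - ‖y - u‖ ^ 2)) ∂complexGaussian v =
      ENNReal.ofReal (Real.exp c / v) := by
  have hv' : (0 : ℝ) < v := NNReal.coe_pos.2 (pos_iff_ne_zero.2 hv)
  have hdensity : ∀ y, complexGaussianPDF 0 v y * Real.exp (c + ‖y‖ ^ 2 / v - ‖y - u‖ ^ 2) =
      Real.exp c / v * complexGaussianPDF u (1 : ℝ≥0) y := fun y => by
    rw [complexGaussianPDF, complexGaussianPDF, mul_assoc, ← Real.exp_add, NNReal.coe_one, mul_one,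
      div_one, sub_zero, show -‖y‖ ^ 2 / v + (c + ‖y‖ ^ 2 / v - ‖y - u‖ ^ 2) =
        c + -‖y - u‖ ^ 2 by ring, Real.exp_add]
    field_simp
  rw [complexGaussian_eq_withDensity hv,
    lintegral_withDensity_eq_lintegral_mul _ (by fun_prop) (by fun_prop)]
  simp only [Pi.mul_apply, ← ENNReal.ofReal_mul (complexGaussianPDF_pos 0 hv' _).le, hdensity,
    ENNReal.ofReal_mul (show 0 ≤ Real.exp c / v by positivity)]
  rw [lintegral_const_mul _ (by fun_prop), lintegral_complexGaussianPDF u one_ne_zero, mul_one]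

lemma gaussianBlock_typical_le (n : ℕ) {v : ℝ≥0} (hv : v ≠ 0) (ε : ℝ) (u : Fin n → ℂ) :
    gaussianBlock n v {y | ∑ t, ‖y t - u t‖ ^ 2 ≤ n * (1 + ε) ∧
        n * (v * (1 - ε)) ≤ ∑ t, ‖y t‖ ^ 2} ≤
      ENNReal.ofReal (Real.exp (2 * ε) / v) ^ n := by
  have hv' : (0 : ℝ) < v := NNReal.coe_pos.2 (pos_iff_ne_zero.2 hv)
  have hchernoff := pi_sum_nonneg_le_prod_lintegral_exp (fun _ : Fin n => complexGaussian v)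
    (g := fun t y => 2 * ε + ‖y‖ ^ 2 / v - ‖y - u t‖ ^ 2) (by fun_prop)
  simp only [lintegral_exp_norm_sq_div_sub _ hv, Finset.prod_const, Finset.card_univ,
    Fintype.card_fin] at hchernoff
  refine (measure_mono ?_).trans hchernoff
  rintro y ⟨hnoise, henergy⟩
  have henergy' : n * (1 - ε) ≤ (∑ t, ‖y t‖ ^ 2) / v := by
    rw [le_div_iff₀ hv']
    linarith
  simp only [Set.mem_ofPred_eq, Finset.sum_sub_distrib, Finset.sum_add_distrib, ← Finset.sum_div,
    Finset.sum_const, Finset.card_univ, Fintype.card_fin, nsmul_eq_mul]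
  linarith

end Blocks

/-! ### Feinstein's maximal code construction -/

section Feinstein

variable {α β : Type*} [MeasurableSpace α] [MeasurableSpace β] {μ : Measure α}
  [IsProbabilityMeasure μ] {κ : Kernel α β} [IsMarkovKernel κ] {G : Set α} {A : Set (α × β)}
  {δ : ℝ≥0∞}

lemma exists_codeword_avoiding (hG : MeasurableSet G) (hA : MeasurableSet A) (hδ : δ ≤ 1)
    {D : Set β} (hD : MeasurableSet D) (hlt : μ Gᶜ + (μ ⊗ₘ κ) Aᶜ + (κ ∘ₘ μ) D < δ) :
    ∃ x ∈ G, κ x (Prod.mk x ⁻¹' A \ D)ᶜ ≤ δ := by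
  by_contra! hbad
  have hpoint : ∀ x, δ ≤ Gᶜ.indicator 1 x + κ x (Prod.mk x ⁻¹' Aᶜ) + κ x D := fun x => by
    by_cases hx : x ∈ G
    · rw [Set.indicator_of_notMem (Set.notMem_compl_iff.2 hx), zero_add]
      refine (hbad x hx).le.trans ((measure_mono fun y hy => ?_).trans (measure_union_le _ _))
      simp only [Set.mem_compl_iff, Set.mem_sdiff, Set.mem_preimage, Set.mem_union] at hy ⊢
      tauto
    · rw [Set.indicator_of_mem hx, add_assoc]
      exact hδ.trans le_self_add
  have hmean := lintegral_mono (μ := μ) hpoint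
  rw [lintegral_const, measure_univ, mul_one, lintegral_add_right _ (κ.measurable_coe hD),
    lintegral_add_right _ (Kernel.measurable_kernel_prodMk_left hA.compl),
    lintegral_indicator_one hG.compl, ← Measure.compProd_apply hA.compl,
    ← Measure.bind_apply hD κ.aemeasurable] at hmean
  exact hlt.not_ge hmean

lemma exists_disjoint_decoding_regions (hG : MeasurableSet G) (hA : MeasurableSet A) (hδ : δ ≤ 1)
    {τ : ℝ≥0∞} (hτ : ∀ x, (κ ∘ₘ μ) (Prod.mk x ⁻¹' A) ≤ τ) (M : ℕ)
    (hlt : μ Gᶜ + (μ ⊗ₘ κ) Aᶜ + M * τ < δ) :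
    ∃ (x : Fin M → α) (B : Fin M → Set β), Pairwise (Function.onFun Disjoint B) ∧
      ∀ w, MeasurableSet (B w) ∧ B w ⊆ Prod.mk (x w) ⁻¹' A ∧ x w ∈ G ∧ κ (x w) (B w)ᶜ ≤ δ := by
  induction M with
  | zero => exact ⟨Fin.elim0, Fin.elim0, fun w => w.elim0, fun w => w.elim0⟩
  | succ M ih =>
    have hmono : (M : ℝ≥0∞) * τ ≤ (M + 1 : ℕ) * τ := by gcongr; exact M.le_succ
    obtain ⟨x, B, hdisj, hB⟩ := ih ((add_le_add_right hmono _).trans_lt hlt)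
    have hused : (κ ∘ₘ μ) (⋃ w, B w) ≤ (M + 1 : ℕ) * τ :=
      calc (κ ∘ₘ μ) (⋃ w, B w) ≤ ∑ w, (κ ∘ₘ μ) (B w) := measure_iUnion_fintype_le _ _
        _ ≤ ∑ _ : Fin M, τ :=
          Finset.sum_le_sum fun w _ => (measure_mono (hB w).2.1).trans (hτ (x w))
        _ = M * τ := by rw [Finset.sum_const, Finset.card_univ, Fintype.card_fin, nsmul_eq_mul]
        _ ≤ (M + 1 : ℕ) * τ := hmono
    obtain ⟨u, huG, hu⟩ := exists_codeword_avoiding hG hA hδ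
      (MeasurableSet.iUnion fun w => (hB w).1) ((add_le_add_right hused _).trans_lt hlt)
    refine ⟨Fin.cons u x, Fin.cons (Prod.mk u ⁻¹' A \ ⋃ w, B w) B, ?_, ?_⟩
    · have : Std.Symm (Function.onFun Disjoint
          (Fin.cons (Prod.mk u ⁻¹' A \ ⋃ w, B w) B : Fin (M + 1) → Set β)) :=
        ⟨fun _ _ h => Disjoint.symm h⟩
      refine pairwise_fin_succ_iff_of_isSymm.2 ⟨fun w => ?_, hdisj⟩
      exact Set.disjoint_sdiff_left.mono_right (Set.subset_iUnion B w)
    · refine Fin.forall_fin_succ.2 ⟨⟨?_, Set.sdiff_subset, huG, hu⟩, hB⟩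
      exact (measurable_prodMk_left hA).diff (MeasurableSet.iUnion fun w => (hB w).1)

theorem exists_code_of_measure_lt (hG : MeasurableSet G) (hA : MeasurableSet A) (hδ : δ ≤ 1)
    {τ : ℝ≥0∞} (hτ : ∀ x, (κ ∘ₘ μ) (Prod.mk x ⁻¹' A) ≤ τ) {M : ℕ} [NeZero M]
    (hlt : μ Gᶜ + (μ ⊗ₘ κ) Aᶜ + M * τ < δ) :
    ∃ (x : Fin M → α) (dec : β → Fin M), Measurable dec ∧ ∀ w, x w ∈ G ∧
      κ (x w) {y | dec y ≠ w} ≤ δ := by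
  obtain ⟨x, B, hdisj, hB⟩ := exists_disjoint_decoding_regions hG hA hδ hτ M hlt
  obtain ⟨dec, hdec, hdecB⟩ := exists_measurable_piecewise B (fun w => (hB w).1) (fun w _ => w)
    (fun _ => measurable_const)
    fun _ _ hne _ hy => (Set.disjoint_left.1 (hdisj hne) hy.1 hy.2).elim
  exact ⟨x, dec, hdec, fun w => ⟨(hB w).2.2.1,
    (measure_mono fun _ (hy : dec _ ≠ w) hyB => hy (hdecB w hyB)).trans (hB w).2.2.2⟩⟩

end Feinstein

section AdditiveNoiseChannel

variable {E : Type*} [AddMonoid E] [MeasurableSpace E] [MeasurableAdd₂ E]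

/-- The channel that adds to its input an independent noise of law `ν`. -/
def additiveNoise (ν : Measure E) : Kernel E E :=
  (Kernel.id ×ₖ Kernel.const E ν).map fun p => p.1 + p.2

variable (ν : Measure E) [IsProbabilityMeasure ν]

instance : IsMarkovKernel (additiveNoise ν) := by
  unfold additiveNoise
  exact Kernel.IsMarkovKernel.map _ measurable_add

lemma additiveNoise_apply (x : E) : additiveNoise ν x = ν.map (x + ·) := by
  rw [additiveNoise, Kernel.map_apply _ measurable_add, Kernel.prod_apply, Kernel.id_apply,
    Kernel.const_apply, Measure.dirac_prod, Measure.map_map measurable_add measurable_prodMk_left]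
  rfl

lemma additiveNoise_comp (μ : Measure E) : additiveNoise ν ∘ₘ μ = μ ∗ ν := by
  refine Measure.ext_of_lintegral _ fun f hf => ?_
  rw [Measure.lintegral_bind (additiveNoise ν).aemeasurable hf.aemeasurable,
    Measure.lintegral_conv hf]
  exact lintegral_congr fun x => by
    rw [additiveNoise_apply, lintegral_map hf (measurable_const_add x)]

lemma compProd_additiveNoise_compl_le {F : Type*} [AddCommGroup F] [MeasurableSpace F]
    [MeasurableAdd₂ F] [MeasurableSub₂ F] (μ ν : Measure F) [SFinite μ] [IsProbabilityMeasure ν]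
    {T U : Set F} (hT : MeasurableSet T) (hU : MeasurableSet U) :
    (μ ⊗ₘ additiveNoise ν) {p | p.2 - p.1 ∈ T ∧ p.2 ∈ U}ᶜ ≤ μ Set.univ * ν Tᶜ + (μ ∗ ν) Uᶜ := by
  have hsub : Measurable fun p : F × F => p.2 - p.1 := measurable_snd.sub measurable_fst
  have hnoise : (μ ⊗ₘ additiveNoise ν) ((fun p => p.2 - p.1) ⁻¹' Tᶜ) = μ Set.univ * ν Tᶜ := by
    rw [Measure.compProd_apply (hsub hT.compl), mul_comm,
      ← lintegral_const]
    refine lintegral_congr fun x => ?_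
    rw [additiveNoise_apply, Measure.map_apply (measurable_const_add x)
      (measurable_prodMk_left (hsub hT.compl))]
    simp only [Set.preimage_preimage, add_sub_cancel_left, Set.preimage_id']
  have houtput : (μ ⊗ₘ additiveNoise ν) (Prod.snd ⁻¹' Uᶜ) = (μ ∗ ν) Uᶜ := by
    rw [← additiveNoise_comp, ← Measure.snd_compProd, Measure.snd_apply hU.compl]
  rw [← hnoise, ← houtput]
  refine (measure_mono fun p hp => ?_).trans (measure_union_le _ _)
  exact not_and_or.1 hp

end AdditiveNoiseChannel

theorem exists_code_additiveNoise {E : Type*} [AddCommGroup E] [MeasurableSpace E]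
    [MeasurableAdd₂ E] [MeasurableSub₂ E] {μ ν : Measure E} [IsProbabilityMeasure μ]
    [IsProbabilityMeasure ν] {G T U : Set E} (hG : MeasurableSet G) (hT : MeasurableSet T)
    (hU : MeasurableSet U) {τ δ : ℝ≥0∞} (hδ : δ ≤ 1)
    (hτ : ∀ x, (μ ∗ ν) {y | y - x ∈ T ∧ y ∈ U} ≤ τ) {M : ℕ} [NeZero M]
    (hlt : μ Gᶜ + ν Tᶜ + (μ ∗ ν) Uᶜ + M * τ < δ) :
    ∃ (x : Fin M → E) (dec : E → Fin M), Measurable dec ∧ ∀ w, x w ∈ G ∧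
      ν {z | dec (x w + z) ≠ w} ≤ δ := by
  have hA : MeasurableSet {p : E × E | p.2 - p.1 ∈ T ∧ p.2 ∈ U} :=
    ((measurable_snd.sub measurable_fst) hT).inter (measurable_snd hU)
  have hfail := compProd_additiveNoise_compl_le μ ν hT hU
  rw [measure_univ, one_mul] at hfail
  have hlt' : μ Gᶜ + (μ ⊗ₘ additiveNoise ν) {p | p.2 - p.1 ∈ T ∧ p.2 ∈ U}ᶜ + M * τ < δ :=
    (add_le_add_left (add_le_add_right hfail _) _).trans_lt (by rwa [← add_assoc])
  obtain ⟨x, dec, hdec, hx⟩ := exists_code_of_measure_lt hG hA hδ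
    (fun x => (additiveNoise_comp ν μ).symm ▸ hτ x) hlt'
  refine ⟨x, dec, hdec, fun w => ⟨(hx w).1, le_of_eq_of_le ?_ (hx w).2⟩⟩
  have hmeas : MeasurableSet {y | dec y ≠ w} := hdec (measurableSet_singleton w).compl
  rw [additiveNoise_apply, Measure.map_apply (measurable_const_add _) hmeas]
  rfl

/-! ### Codes for the complex Gaussian channel -/

lemma exists_pos_lt_log_one_add {P R : ℝ} (hP : 0 < P) (hR : R < Real.log (1 + P)) :
    ∃ p, 0 < p ∧ p < P ∧ R < Real.log (1 + p) := by
  have hcont : ContinuousAt (fun p : ℝ => Real.log (1 + p)) P :=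
    ContinuousAt.log (by fun_prop) (by positivity)
  obtain ⟨p, hp, hp0, hpP⟩ := (((hcont.tendsto.mono_left nhdsWithin_le_nhds).eventually
    (lt_mem_nhds hR)).and (Ioo_mem_nhdsLT hP)).exists
  exact ⟨p, hp0, hpP, hp⟩

/-- The codebook of `exists_code_additiveNoise` is drawn with a power `p` slightly below `P`, so
that typical codewords satisfy the power constraint `P`. -/
theorem eventually_exists_gaussian_code {P R : ℝ} (hP : 0 < P) (hR : R < Real.log (1 + P))
    {δ : ℝ≥0∞} (hδ : δ ≠ 0) :
    ∀ᶠ n : ℕ in atTop, ∀ (M : ℕ) [NeZero M], (M : ℝ) ≤ Real.exp (R * n) →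
      ∃ (x : Fin M → Fin n → ℂ) (dec : (Fin n → ℂ) → Fin M), Measurable dec ∧
        ∀ w, ∑ t, ‖x w t‖ ^ 2 ≤ n * P ∧ blockNoise n {z | dec (x w + z) ≠ w} ≤ δ := by
  obtain ⟨p, hp0, hpP, hpR⟩ := exists_pos_lt_log_one_add hP hR
  lift p to ℝ≥0 using hp0.le
  obtain ⟨ε, hε, hεR⟩ : ∃ ε : ℝ, 0 < ε ∧ R + 2 * ε < Real.log (1 + p) :=
    ⟨(Real.log (1 + p) - R) / 4, by linarith, by linarith⟩
  have hv : (0 : ℝ) < (p + 1 : ℝ≥0) := by positivity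
  have hq : Real.exp R * (Real.exp (2 * ε) / (p + 1 : ℝ≥0)) < 1 := by
    rw [← mul_div_assoc, ← Real.exp_add, div_lt_one hv, ← Real.lt_log_iff_exp_lt hv]
    rwa [NNReal.coe_add, NNReal.coe_one, add_comm (p : ℝ)]
  have hlim := (((tendsto_gaussianBlock_lt_energy hpP).add
    (tendsto_gaussianBlock_lt_energy (v := 1) (show ((1 : ℝ≥0) : ℝ) < 1 + ε by simpa))).add
    (tendsto_gaussianBlock_energy_lt (v := p + 1) (p := (p + 1 : ℝ≥0) * (1 - ε))
      (mul_lt_of_lt_one_right hv (by linarith)))).add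
    (ENNReal.tendsto_pow_atTop_nhds_zero_of_lt_one (ENNReal.ofReal_lt_one.2 hq))
  simp only [add_zero] at hlim
  filter_upwards [hlim.eventually (gt_mem_nhds (lt_min (pos_iff_ne_zero.2 hδ) one_pos))]
    with n hn M _ hM
  have hcount : (M : ℝ≥0∞) * ENNReal.ofReal (Real.exp (2 * ε) / (p + 1 : ℝ≥0)) ^ n ≤
      ENNReal.ofReal (Real.exp R * (Real.exp (2 * ε) / (p + 1 : ℝ≥0))) ^ n := by
    rw [ENNReal.ofReal_mul (Real.exp_pos R).le, mul_pow, ← ENNReal.ofReal_pow (Real.exp_pos R).le,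
      ← Real.exp_nat_mul, mul_comm (n : ℝ) R, ← ENNReal.ofReal_natCast M]
    gcongr
  obtain ⟨x, dec, hdec, hx⟩ := exists_code_additiveNoise (μ := gaussianBlock n p)
    (ν := blockNoise n) (G := {x | ∑ t, ‖x t‖ ^ 2 ≤ n * P})
    (T := {z | ∑ t, ‖z t‖ ^ 2 ≤ n * (1 + ε)})
    (U := {y | n * ((p + 1 : ℝ≥0) * (1 - ε)) ≤ ∑ t, ‖y t‖ ^ 2}) (M := M)
    (by measurability) (by measurability) (by measurability) (min_le_right δ 1)
    (fun x => by
      rw [← gaussianBlock_one, gaussianBlock_conv_gaussianBlock]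
      exact gaussianBlock_typical_le n (by positivity) ε x)
    (lt_of_le_of_lt (by
      rw [← gaussianBlock_one, gaussianBlock_conv_gaussianBlock]
      simp only [Set.compl_ofPred, not_le]
      gcongr) hn)
  exact ⟨x, dec, hdec, fun w => ⟨(hx w).1, (hx w).2.trans (min_le_left δ 1)⟩⟩

/-! ### Time sharing with a beamforming relay -/

lemma map_comp_pi_of_injective {ι κ α : Type*} [Fintype ι] [Fintype κ] [MeasurableSpace α]
    (μ : Measure α) [IsProbabilityMeasure μ] {e : κ → ι} (he : Function.Injective e) :
    (Measure.pi fun _ : ι => μ).map (· ∘ e) = Measure.pi fun _ : κ => μ := by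
  have hind : iIndepFun (fun i (x : ι → α) => x i) (Measure.pi fun _ : ι => μ) :=
    iIndepFun_pi fun _ => aemeasurable_id
  refine ((iIndepFun_iff_map_fun_eq_pi_map fun t => (measurable_pi_apply (e t)).aemeasurable).1
    (hind.precomp he)).trans ?_
  simp only [(measurePreserving_eval (fun _ : ι => μ) _).map_eq]

lemma sum_norm_sq_extend {ι κ E : Type*} [Fintype ι] [Fintype κ] [SeminormedAddGroup E]
    {e : κ → ι} (he : Function.Injective e) (u : κ → E) :
    ∑ s, ‖Function.extend e u 0 s‖ ^ 2 = ∑ t, ‖u t‖ ^ 2 := by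
  rw [← tsum_fintype (L := .unconditional κ), ← tsum_extend_zero he, tsum_fintype]
  refine Finset.sum_congr rfl fun s _ => ?_
  rw [Function.apply_extend (fun x : E => ‖x‖ ^ 2)]
  congr 1
  ext
  simp

lemma IFCCRCode.powerConstraint_of_forall_le {N M₁ M₂ : ℕ} {c : IFCCRCode N M₁ M₂}
    (h : ∀ i w₁ w₂, ∑ t, ‖c.input w₁ w₂ i t‖ ^ 2 ≤ N) : c.PowerConstraint := fun i =>
  calc ∑ w₁, ∑ w₂, ∑ t, ‖c.input w₁ w₂ i t‖ ^ 2 ≤ ∑ _w₁ : Fin M₁, ∑ _w₂ : Fin M₂, (N : ℝ) :=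
        Finset.sum_le_sum fun w₁ _ => Finset.sum_le_sum fun w₂ _ => h i w₁ w₂
    _ = N * (M₁ * M₂) := by
        simp only [Finset.sum_const, Finset.card_univ, Fintype.card_fin, nsmul_eq_mul]
        ring

/-- Transmitters 1 and 2 send point-to-point codewords in the sets of time slots `e₁` and `e₂`,
and are silent otherwise; both receivers decode the two parts of the block separately. -/
def timeSharingCode {m₁ m₂ N M₁ M₂ : ℕ} (e₁ : Fin m₁ ↪ Fin N) (e₂ : Fin m₂ ↪ Fin N)
    (x₁ : Fin M₁ → Fin m₁ → ℂ) (x₂ : Fin M₂ → Fin m₂ → ℂ) {dec₁ : (Fin m₁ → ℂ) → Fin M₁}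
    {dec₂ : (Fin m₂ → ℂ) → Fin M₂} (hdec₁ : Measurable dec₁) (hdec₂ : Measurable dec₂) :
    BeamformingCode N M₁ M₂ where
  enc₁ w := Function.extend e₁ (x₁ w) 0
  enc₂ w := Function.extend e₂ (x₂ w) 0
  dec₁ y := (dec₁ fun t => y (e₁ t), dec₂ fun t => y (e₂ t))
  dec₂ y := (dec₁ fun t => y (e₁ t), dec₂ fun t => y (e₂ t))
  measurable_dec₁ := by fun_prop
  measurable_dec₂ := by fun_prop

section TimeSharing

variable {m₁ m₂ N M₁ M₂ : ℕ} {e₁ : Fin m₁ ↪ Fin N} {e₂ : Fin m₂ ↪ Fin N}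
  {x₁ : Fin M₁ → Fin m₁ → ℂ} {x₂ : Fin M₂ → Fin m₂ → ℂ} {dec₁ : (Fin m₁ → ℂ) → Fin M₁}
  {dec₂ : (Fin m₂ → ℂ) → Fin M₂} {hdec₁ : Measurable dec₁} {hdec₂ : Measurable dec₂} {a b : ℂ}

lemma norm_sq_beamforming_eq (he : ∀ s t, e₁ s ≠ e₂ t) (u : Fin m₁ → ℂ) (v : Fin m₂ → ℂ)
    (t : Fin N) :
    ‖a * Function.extend e₁ u 0 t + b * Function.extend e₂ v 0 t‖ ^ 2 =
      ‖a‖ ^ 2 * ‖Function.extend e₁ u 0 t‖ ^ 2 + ‖b‖ ^ 2 * ‖Function.extend e₂ v 0 t‖ ^ 2 := by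
  by_cases ht : ∃ s, e₁ s = t
  · obtain ⟨s, rfl⟩ := ht
    rw [Function.extend_apply' v _ _ fun ⟨s', h⟩ => he s s' h.symm]
    simp [mul_pow]
  · rw [Function.extend_apply' u _ _ ht]
    simp [mul_pow]

/-- As the primary transmitters are never active simultaneously, the energies of their parts of
the relay's block add up. -/
lemma timeSharingCode_powerConstraint (he : ∀ s t, e₁ s ≠ e₂ t)
    (hx₁ : ∀ w, ∑ t, ‖x₁ w t‖ ^ 2 ≤ N) (hx₂ : ∀ w, ∑ t, ‖x₂ w t‖ ^ 2 ≤ N)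
    (hab : ‖a‖ ^ 2 + ‖b‖ ^ 2 ≤ 1) :
    ((timeSharingCode e₁ e₂ x₁ x₂ hdec₁ hdec₂).toIFCCR a b).PowerConstraint := by
  refine IFCCRCode.powerConstraint_of_forall_le fun i w₁ w₂ => ?_
  have henergy₁ := (sum_norm_sq_extend e₁.injective (x₁ w₁)).trans_le (hx₁ w₁)
  have henergy₂ := (sum_norm_sq_extend e₂.injective (x₂ w₂)).trans_le (hx₂ w₂)
  fin_cases i
  · exact henergy₁
  · exact henergy₂
  · calc ∑ t, ‖a * Function.extend e₁ (x₁ w₁) 0 t + b * Function.extend e₂ (x₂ w₂) 0 t‖ ^ 2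
        = ‖a‖ ^ 2 * ∑ t, ‖Function.extend e₁ (x₁ w₁) 0 t‖ ^ 2 +
            ‖b‖ ^ 2 * ∑ t, ‖Function.extend e₂ (x₂ w₂) 0 t‖ ^ 2 := by
          simp only [norm_sq_beamforming_eq he, Finset.sum_add_distrib, Finset.mul_sum]
      _ ≤ ‖a‖ ^ 2 * N + ‖b‖ ^ 2 * N := by gcongr
      _ = (‖a‖ ^ 2 + ‖b‖ ^ 2) * N := by ring
      _ ≤ N := mul_le_of_le_one_left (Nat.cast_nonneg N) hab

variable {H : Matrix (Fin 3) (Fin 3) ℂ} (l : Fin 3) (w₁ : Fin M₁)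
  (w₂ : Fin M₂) (z : Fin N → ℂ)

lemma received_timeSharingCode_left (he : ∀ s t, e₁ s ≠ e₂ t) :
    (fun t => received H l
        (((timeSharingCode e₁ e₂ x₁ x₂ hdec₁ hdec₂).toIFCCR a b).input w₁ w₂) z (e₁ t)) =
      (H l 0 + H l 2 * a) • x₁ w₁ + z ∘ e₁ := by
  ext t
  simp only [received, Fin.sum_univ_three, IFCCRCode.input, BeamformingCode.toIFCCR,
    timeSharingCode, Matrix.cons_val_zero, Matrix.cons_val_one, Matrix.cons_val,
    e₁.injective.extend_apply, Function.extend_apply' _ _ _ fun ⟨s, h⟩ => he t s h.symm,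
    Pi.zero_apply, Pi.add_apply, Pi.smul_apply, smul_eq_mul, Function.comp_apply]
  ring

lemma received_timeSharingCode_right (he : ∀ s t, e₁ s ≠ e₂ t) :
    (fun t => received H l
        (((timeSharingCode e₁ e₂ x₁ x₂ hdec₁ hdec₂).toIFCCR a b).input w₁ w₂) z (e₂ t)) =
      (H l 1 + H l 2 * b) • x₂ w₂ + z ∘ e₂ := by
  ext t
  simp only [received, Fin.sum_univ_three, IFCCRCode.input, BeamformingCode.toIFCCR,
    timeSharingCode, Matrix.cons_val_zero, Matrix.cons_val_one, Matrix.cons_val,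
    e₂.injective.extend_apply, Function.extend_apply' _ _ _ fun ⟨s, h⟩ => he s t h,
    Pi.zero_apply, Pi.add_apply, Pi.smul_apply, smul_eq_mul, Function.comp_apply]
  ring

lemma blockNoise_decoding_error_comp {m M : ℕ} (e : Fin m ↪ Fin N) {dec : (Fin m → ℂ) → Fin M}
    (hdec : Measurable dec) (x : Fin m → ℂ) (w : Fin M) :
    blockNoise N {z | dec (x + z ∘ e) ≠ w} = blockNoise m {z | dec (x + z) ≠ w} := by
  have hmeas : MeasurableSet {z | dec (x + z) ≠ w} :=
    (hdec.comp (measurable_const_add x)) (measurableSet_singleton w).compl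
  have hcomp : (blockNoise N).map (· ∘ e) = blockNoise m :=
    map_comp_pi_of_injective stdComplexGaussian e.injective
  rw [← hcomp, Measure.map_apply (by fun_prop) hmeas]
  rfl

lemma timeSharingCode_error_le (he : ∀ s t, e₁ s ≠ e₂ t) {δ₁ δ₂ : ℝ≥0∞}
    (h₁ : blockNoise m₁ {z | dec₁ ((H l 0 + H l 2 * a) • x₁ w₁ + z) ≠ w₁} ≤ δ₁)
    (h₂ : blockNoise m₂ {z | dec₂ ((H l 1 + H l 2 * b) • x₂ w₂ + z) ≠ w₂} ≤ δ₂) :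
    blockNoise N {z | (timeSharingCode e₁ e₂ x₁ x₂ hdec₁ hdec₂).dec₁ (received H l
      (((timeSharingCode e₁ e₂ x₁ x₂ hdec₁ hdec₂).toIFCCR a b).input w₁ w₂) z) ≠ (w₁, w₂)} ≤
      δ₁ + δ₂ := by
  rw [← blockNoise_decoding_error_comp e₁ hdec₁] at h₁
  rw [← blockNoise_decoding_error_comp e₂ hdec₂] at h₂
  refine (measure_mono fun z hz => ?_).trans ((measure_union_le _ _).trans (add_le_add h₁ h₂))
  by_contra hcorrect
  simp only [Set.mem_union, Set.mem_ofPred_eq, not_or, not_not] at hcorrect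
  refine hz (Prod.ext ?_ ?_)
  · exact (congrArg dec₁ (received_timeSharingCode_left l w₁ w₂ z he)).trans hcorrect.1
  · exact (congrArg dec₂ (received_timeSharingCode_right l w₁ w₂ z he)).trans hcorrect.2

end TimeSharing

/-! ### Achievable rates of beamforming -/

lemma exists_seq_tendsto_zero {C : ℕ → Type*} [∀ n, Nonempty (C n)] {f : ∀ n, C n → ℝ}
    (hf : ∀ n c, 0 ≤ f n c) (h : ∀ δ > 0, ∀ᶠ n in atTop, ∃ c, f n c ≤ δ) :
    ∃ c : ∀ n, C n, Tendsto (fun n => f n (c n)) atTop (𝓝 0) := by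
  have hnear (n : ℕ) : ∃ c, f n c < (⨅ c, f n c) + 1 / ((n : ℝ) + 1) :=
    exists_lt_of_ciInf_lt (lt_add_of_pos_right _ Nat.one_div_pos_of_nat)
  choose c hc using hnear
  have hinf : Tendsto (fun n => ⨅ c, f n c) atTop (𝓝 0) := by
    refine tendsto_order.2 ⟨fun δ hδ => .of_forall fun n => ?_, fun δ hδ => ?_⟩
    · exact hδ.trans_le (Real.iInf_nonneg (hf n))
    · filter_upwards [h (δ / 2) (half_pos hδ)] with n ⟨c, hcδ⟩
      have hbdd : BddBelow (Set.range (f n)) := ⟨0, Set.forall_mem_range.2 (hf n)⟩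
      exact ((ciInf_le hbdd c).trans hcδ).trans_lt (half_lt_self hδ)
  refine ⟨c, squeeze_zero (fun n => hf n (c n)) (fun n => (hc n).le) ?_⟩
  simpa using hinf.add (tendsto_one_div_add_atTop_nhds_zero_nat (𝕜 := ℝ))

lemma average_le_of_le {M₁ M₂ : ℕ} {f : Fin M₁ → Fin M₂ → ℝ} {δ : ℝ} (hδ : 0 ≤ δ)
    (hf : ∀ i j, f i j ≤ δ) : (∑ i, ∑ j, f i j) / ((M₁ : ℝ) * M₂) ≤ δ := by
  refine div_le_of_le_mul₀ (by positivity) hδ ?_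
  calc ∑ i, ∑ j, f i j ≤ ∑ _i : Fin M₁, ∑ _j : Fin M₂, δ :=
        Finset.sum_le_sum fun i _ => Finset.sum_le_sum fun j _ => hf i j
    _ = δ * (M₁ * M₂) := by
        simp only [Finset.sum_const, Finset.card_univ, Fintype.card_fin, nsmul_eq_mul]
        ring

instance (N : ℕ) (R : ℝ) : NeZero (numMessages N R) :=
  ⟨(Nat.ceil_pos.2 (Real.rpow_pos_of_pos two_pos _)).ne'⟩

instance (N M₁ M₂ : ℕ) [NeZero M₁] [NeZero M₂] (a b : ℂ) :
    Nonempty {c : BeamformingCode N M₁ M₂ // (c.toIFCCR a b).PowerConstraint} := by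
  refine ⟨⟨0, 0, 0, 0, measurable_const, measurable_const⟩,
    IFCCRCode.powerConstraint_of_forall_le fun i w₁ w₂ => ?_⟩
  fin_cases i <;> simp [IFCCRCode.input, BeamformingCode.toIFCCR]

lemma beamformingAchievable_of_eventually {H : Matrix (Fin 3) (Fin 3) ℂ} {R₁ R₂ : ℝ}
    (hR₁ : 0 ≤ R₁) (hR₂ : 0 ≤ R₂) (a b : ℂ)
    (h : ∀ δ > 0, ∀ᶠ N : ℕ in atTop,
      ∃ c : BeamformingCode N (numMessages N R₁) (numMessages N R₂),
        (c.toIFCCR a b).PowerConstraint ∧ c.jointError₁ H a b ≤ δ ∧ c.jointError₂ H a b ≤ δ) :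
    BeamformingAchievable H R₁ R₂ := by
  obtain ⟨c, hc⟩ := exists_seq_tendsto_zero
    (C := fun N => {c : BeamformingCode N (numMessages N R₁) (numMessages N R₂) //
      (c.toIFCCR a b).PowerConstraint})
    (f := fun N c => max (c.1.jointError₁ H a b) (c.1.jointError₂ H a b))
    (fun N c => le_max_of_le_left (by unfold BeamformingCode.jointError₁; positivity))
    fun δ hδ => (h δ hδ).mono fun N ⟨c, hpow, h₁, h₂⟩ => ⟨⟨c, hpow⟩, max_le h₁ h₂⟩
  exact ⟨hR₁, hR₂, a, b, fun N => c N, fun N => (c N).2, hc⟩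

lemma BeamformingAchievable.ifccrAchievable {H : Matrix (Fin 3) (Fin 3) ℂ} {R₁ R₂ : ℝ}
    (h : BeamformingAchievable H R₁ R₂) : IFCCRAchievable H R₁ R₂ := by
  obtain ⟨hR₁, hR₂, a, b, c, hpow, hlim⟩ := h
  refine ⟨hR₁, hR₂, fun N => (c N).toIFCCR a b, hpow,
    squeeze_zero (fun N => le_max_of_le_left ?_) (fun N => max_le_max ?_ ?_) hlim⟩
  · unfold IFCCRCode.error₁
    positivity
  · unfold IFCCRCode.error₁ BeamformingCode.jointError₁
    gcongr with w₁ _ w₂ _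
    · exact measure_ne_top _ _
    · exact congrArg Prod.fst
  · unfold IFCCRCode.error₂ BeamformingCode.jointError₂
    gcongr with w₁ _ w₂ _
    · exact measure_ne_top _ _
    · exact congrArg Prod.snd

lemma eventually_numMessages_le {R R' θ : ℝ} (hR : 0 ≤ R) (hR' : 0 ≤ R')
    (hlt : R * Real.log 2 < R' * θ) :
    ∀ᶠ N : ℕ in atTop, (numMessages N R : ℝ) ≤ Real.exp (R' * ⌊θ * N⌋₊) := by
  have hlim : Tendsto (fun N : ℕ => (N : ℝ) * (R' * θ - R * Real.log 2)) atTop atTop :=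
    tendsto_natCast_atTop_atTop.atTop_mul_const (sub_pos.2 hlt)
  filter_upwards [hlim.eventually_ge_atTop (Real.log 2 + R')] with N hN
  have hpow : (1 : ℝ) ≤ 2 ^ (N * R) := Real.one_le_rpow one_le_two (by positivity)
  calc (numMessages N R : ℝ) ≤ 2 * 2 ^ (N * R) :=
        Nat.ceil_le_two_mul ((by norm_num : (2⁻¹ : ℝ) ≤ 1).trans hpow)
    _ = Real.exp (Real.log 2 + Real.log 2 * (N * R)) := by
        rw [Real.exp_add, Real.exp_log two_pos, Real.rpow_def_of_pos two_pos]
    _ ≤ Real.exp (R' * (θ * N - 1)) := by gcongr; linarith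
    _ ≤ Real.exp (R' * ⌊θ * N⌋₊) := by gcongr; exact (Nat.sub_one_lt_floor _).le

/-- A transmitter that is active a fraction `θ` of the time may use the power `1 / θ` there. -/
lemma eventually_exists_scaled_code {θ R : ℝ} {g : ℂ} (hθ : 0 < θ) (hR : 0 ≤ R)
    (hlt : R < θ * Real.logb 2 (1 + ‖g‖ ^ 2 / θ)) {δ : ℝ≥0∞} (hδ : δ ≠ 0) :
    ∀ᶠ N : ℕ in atTop, ∃ (x : Fin (numMessages N R) → Fin ⌊θ * N⌋₊ → ℂ)
      (dec : (Fin ⌊θ * N⌋₊ → ℂ) → Fin (numMessages N R)), Measurable dec ∧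
      ∀ w, ∑ t, ‖x w t‖ ^ 2 ≤ N ∧ blockNoise _ {z | dec (g • x w + z) ≠ w} ≤ δ := by
  have hg : g ≠ 0 := by
    rintro rfl
    simp [hR.not_gt] at hlt
  have hlog : R * Real.log 2 / θ < Real.log (1 + ‖g‖ ^ 2 / θ) := by
    rwa [Real.logb, ← mul_div_assoc, lt_div_iff₀ (Real.log_pos one_lt_two), mul_comm θ,
      ← div_lt_iff₀ hθ] at hlt
  obtain ⟨R', hRR', hR'⟩ := exists_between hlog
  have hfloor : Tendsto (fun N : ℕ => ⌊θ * N⌋₊) atTop atTop :=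
    (tendsto_nat_floor_mul_atTop θ hθ).comp tendsto_natCast_atTop_atTop
  filter_upwards [hfloor.eventually (eventually_exists_gaussian_code (by positivity) hR' hδ),
    eventually_numMessages_le hR ((by positivity : 0 ≤ R * Real.log 2 / θ).trans hRR'.le)
      ((div_lt_iff₀ hθ).1 hRR')] with N hcode hM
  obtain ⟨u, dec, hdec, hu⟩ := hcode _ hM
  refine ⟨fun w => g⁻¹ • u w, dec, hdec, fun w => ⟨?_, ?_⟩⟩
  · calc ∑ t, ‖(g⁻¹ • u w) t‖ ^ 2 = (‖g‖ ^ 2)⁻¹ * ∑ t, ‖u w t‖ ^ 2 := by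
          simp only [Pi.smul_apply, norm_smul, norm_inv, mul_pow, inv_pow, Finset.mul_sum]
      _ ≤ (‖g‖ ^ 2)⁻¹ * (θ * N * (‖g‖ ^ 2 / θ)) := by
          gcongr
          exact (hu w).1.trans (by gcongr; exact Nat.floor_le (by positivity))
      _ = N := by field_simp
  · simpa only [smul_inv_smul₀ hg] using (hu w).2

lemma exists_disjoint_embeddings {m₁ m₂ N : ℕ} (h : m₁ + m₂ ≤ N) :
    ∃ (e₁ : Fin m₁ ↪ Fin N) (e₂ : Fin m₂ ↪ Fin N), ∀ s t, e₁ s ≠ e₂ t := by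
  refine ⟨(Fin.castAddEmb m₂).trans (Fin.castLEEmb h), (Fin.natAddEmb m₁).trans (Fin.castLEEmb h),
    fun s t hst => ?_⟩
  have hval : (s : ℕ) = m₁ + t := congrArg Fin.val hst
  omega

theorem beamformingAchievable_of_lt_logb {H : Matrix (Fin 3) (Fin 3) ℂ} (hrow : H 1 = H 0)
    {a b : ℂ} (hab : ‖a‖ ^ 2 + ‖b‖ ^ 2 ≤ 1) {θ₁ θ₂ : ℝ} (hθ₁ : 0 < θ₁) (hθ₂ : 0 < θ₂)
    (hθ : θ₁ + θ₂ ≤ 1) {R₁ R₂ : ℝ} (hR₁ : 0 ≤ R₁) (hR₂ : 0 ≤ R₂)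
    (hlt₁ : R₁ < θ₁ * Real.logb 2 (1 + ‖H 0 0 + H 0 2 * a‖ ^ 2 / θ₁))
    (hlt₂ : R₂ < θ₂ * Real.logb 2 (1 + ‖H 0 1 + H 0 2 * b‖ ^ 2 / θ₂)) :
    BeamformingAchievable H R₁ R₂ := by
  refine beamformingAchievable_of_eventually hR₁ hR₂ a b fun δ hδ => ?_
  have hδ' : ENNReal.ofReal (δ / 2) ≠ 0 := (ENNReal.ofReal_pos.2 (half_pos hδ)).ne'
  filter_upwards [eventually_exists_scaled_code hθ₁ hR₁ hlt₁ hδ',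
    eventually_exists_scaled_code hθ₂ hR₂ hlt₂ hδ'] with N hcode₁ hcode₂
  obtain ⟨x₁, dec₁, hdec₁, hx₁⟩ := hcode₁
  obtain ⟨x₂, dec₂, hdec₂, hx₂⟩ := hcode₂
  have hslots : ⌊θ₁ * N⌋₊ + ⌊θ₂ * N⌋₊ ≤ N := by
    rify
    calc (⌊θ₁ * N⌋₊ : ℝ) + ⌊θ₂ * N⌋₊ ≤ θ₁ * N + θ₂ * N := by
          gcongr <;> exact Nat.floor_le (by positivity)
      _ = (θ₁ + θ₂) * N := by ring
      _ ≤ N := mul_le_of_le_one_left (Nat.cast_nonneg N) hθ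
  obtain ⟨e₁, e₂, he⟩ := exists_disjoint_embeddings hslots
  let c := timeSharingCode e₁ e₂ x₁ x₂ hdec₁ hdec₂
  have herr (l : Fin 3) (hl : H l = H 0) (w₁ w₂) : (blockNoise N).real
      {z | c.dec₁ (received H l ((c.toIFCCR a b).input w₁ w₂) z) ≠ (w₁, w₂)} ≤ δ := by
    refine ENNReal.toReal_le_of_le_ofReal hδ.le ?_
    rw [← add_halves δ, ENNReal.ofReal_add (half_pos hδ).le (half_pos hδ).le]
    exact timeSharingCode_error_le l w₁ w₂ he (by rw [hl]; exact (hx₁ w₁).2)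
      (by rw [hl]; exact (hx₂ w₂).2)
  exact ⟨c, timeSharingCode_powerConstraint he (fun w => (hx₁ w).1) (fun w => (hx₂ w).1) hab,
    average_le_of_le hδ.le (herr 0 rfl), average_le_of_le hδ.le (herr 1 hrow)⟩

lemma exists_norm_add_mul_eq (d c : ℂ) {r : ℝ} (hr : 0 ≤ r) :
    ∃ a : ℂ, ‖a‖ = r ∧ ‖d + c * a‖ = ‖d‖ + ‖c‖ * r := by
  refine ⟨r * Complex.exp ((d.arg - c.arg : ℝ) * Complex.I), ?_, ?_⟩
  · rw [norm_mul, Complex.norm_exp_ofReal_mul_I, mul_one, Complex.norm_of_nonneg hr]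
  · have hphase : c * Complex.exp ((d.arg - c.arg : ℝ) * Complex.I) =
        ‖c‖ * Complex.exp (d.arg * Complex.I) := by
      conv_lhs => arg 1; rw [← Complex.norm_mul_exp_arg_mul_I c]
      rw [mul_assoc, ← Complex.exp_add, Complex.ofReal_sub, sub_mul, add_sub_cancel]
    have haligned : d + c * (r * Complex.exp ((d.arg - c.arg : ℝ) * Complex.I)) =
        (‖d‖ + ‖c‖ * r : ℝ) * Complex.exp (d.arg * Complex.I) := by
      push_cast at hphase ⊢
      linear_combination r * hphase - Complex.norm_mul_exp_arg_mul_I d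
    rw [haligned, norm_mul, Complex.norm_exp_ofReal_mul_I, mul_one,
      Complex.norm_of_nonneg (by positivity)]

/-- The relay splits its power equally between the two primary codewords and aligns each with the
direct signal; the fractions of time proportional to the received powers `g₁` and `g₂` give the
sum rate of a multiple-access channel with total received power `g₁ + g₂`. -/
theorem exists_beamformingAchievable {H : Matrix (Fin 3) (Fin 3) ℂ} (hrow : H 1 = H 0)
    (hne : H 0 2 ≠ 0) {R : ℝ} (hR : 0 ≤ R)
    (hlt : R < Real.logb 2 (1 + ((‖H 0 0‖ + ‖H 0 2‖ * √(1 / 2)) ^ 2 +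
      (‖H 0 1‖ + ‖H 0 2‖ * √(1 / 2)) ^ 2))) :
    ∃ R₁ R₂, R₁ + R₂ = R ∧ BeamformingAchievable H R₁ R₂ := by
  obtain ⟨a, ha, hga⟩ := exists_norm_add_mul_eq (H 0 0) (H 0 2) (Real.sqrt_nonneg (1 / 2))
  obtain ⟨b, hb, hgb⟩ := exists_norm_add_mul_eq (H 0 1) (H 0 2) (Real.sqrt_nonneg (1 / 2))
  have hab : ‖a‖ ^ 2 + ‖b‖ ^ 2 ≤ 1 := by
    rw [ha, hb, Real.sq_sqrt (by norm_num)]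
    norm_num
  rw [← hga, ← hgb] at hlt
  set g₁ := ‖H 0 0 + H 0 2 * a‖ ^ 2 with hg₁
  set g₂ := ‖H 0 1 + H 0 2 * b‖ ^ 2 with hg₂
  have hg₁pos : 0 < g₁ := by rw [hg₁, hga]; positivity
  have hg₂pos : 0 < g₂ := by rw [hg₂, hgb]; positivity
  have hfrac : g₁ / (g₁ + g₂) + g₂ / (g₁ + g₂) = 1 := by field_simp
  have hpower {g : ℝ} (hg : 0 < g) : g / (g / (g₁ + g₂)) = g₁ + g₂ := by field_simp
  refine ⟨g₁ / (g₁ + g₂) * R, g₂ / (g₁ + g₂) * R, by rw [← add_mul, hfrac, one_mul],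
    beamformingAchievable_of_lt_logb hrow hab (by positivity) (by positivity) hfrac.le
      (by positivity) (by positivity) ?_ ?_⟩
  · rw [hpower hg₁pos]
    gcongr
  · rw [hpower hg₂pos]
    gcongr

lemma half_one_add_sq_lt_beamforming {d i c : ℝ} (hd : 0 ≤ d) (hi : 0 ≤ i) (hc : 0 ≤ c) :
    (1 + (d + i + c) ^ 2) / 2 < 1 + ((d + c * √(1 / 2)) ^ 2 + (i + c * √(1 / 2)) ^ 2) := by
  have hsqrt : 1 / 2 ≤ √(1 / 2 : ℝ) := Real.le_sqrt_of_sq_le (by norm_num)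
  have hcs : c * (1 / 2) ≤ c * √(1 / 2) := by gcongr
  have hsum : d + i + c ≤ (d + c * √(1 / 2)) + (i + c * √(1 / 2)) := by linarith
  calc (1 + (d + i + c) ^ 2) / 2
      ≤ (1 + ((d + c * √(1 / 2)) + (i + c * √(1 / 2))) ^ 2) / 2 := by gcongr
    _ < 1 + ((d + c * √(1 / 2)) ^ 2 + (i + c * √(1 / 2)) ^ 2) := by
        linarith [add_sq_le (a := d + c * √(1 / 2)) (b := i + c * √(1 / 2))]

/-! ### Rigidity of the strong-interference condition -/

/-- The correlations `ρ₁ = √(1 - ‖w‖²)`, `ρ₂ = 0`, `ρ₃ = w` make the conditional covariance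
degenerate, with `X₂ = w X₃` given `X₁`. -/
lemma condCov_eq_vecMulVec {w : ℂ} (hw : ‖w‖ ≤ 1) :
    condCov (√(1 - ‖w‖ ^ 2) : ℝ) 0 w = Matrix.vecMulVec ![w, 1] (star ![w, 1]) := by
  have hvar : (1 : ℂ) - (‖((√(1 - ‖w‖ ^ 2) : ℝ) : ℂ)‖ : ℂ) ^ 2 = w * conj w := by
    rw [Complex.norm_of_nonneg (Real.sqrt_nonneg _), ← Complex.ofReal_pow,
      Real.sq_sqrt (sub_nonneg.2 (pow_le_one₀ (norm_nonneg w) hw)), Complex.mul_conj']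
    push_cast
    ring
  ext i j
  fin_cases i <;> fin_cases j
  · exact hvar.trans rfl
  all_goals simp [condCov, Matrix.vecMulVec_apply]

lemma quadForm_vecMulVec (w u v : ℂ) :
    quadForm (Matrix.vecMulVec ![w, 1] (star ![w, 1])) u v = ‖u * w + v‖ ^ 2 := by
  have hmul : ![u, v] ⬝ᵥ (Matrix.vecMulVec ![w, 1] (star ![w, 1]) *ᵥ star ![u, v]) =
      (u * w + v) * conj (u * w + v) := by
    simp only [Matrix.mulVec, dotProduct, Matrix.vecMulVec_apply, Fin.sum_univ_two,
      Matrix.cons_val_zero, Matrix.cons_val_one, Pi.star_apply, RCLike.star_def, map_add, map_mul,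
      map_one]
    ring
  rw [quadForm, hmul, Complex.mul_conj', ← Complex.ofReal_pow, Complex.ofReal_re]

lemma StrongInterference.norm_sq_le {hd hi hc : ℂ} (h : StrongInterference hd hi hc) {w : ℂ}
    (hw : ‖w‖ ≤ 1) : ‖(‖hd‖ : ℂ) * w + hc‖ ^ 2 ≤ ‖hi * w + hc‖ ^ 2 := by
  have hρ : ‖((√(1 - ‖w‖ ^ 2) : ℝ) : ℂ)‖ ≤ 1 := by
    rw [Complex.norm_of_nonneg (Real.sqrt_nonneg _), Real.sqrt_le_one]
    exact sub_le_self _ (sq_nonneg _)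
  have hlog := h _ 0 w hρ (by simp) hw
    (condCov_eq_vecMulVec hw ▸ Matrix.posSemidef_vecMulVec_self_star _)
  rw [condCov_eq_vecMulVec hw, quadForm_vecMulVec, quadForm_vecMulVec,
    Real.logb_le_logb one_lt_two (by positivity) (by positivity)] at hlog
  exact le_of_add_le_add_left hlog

/-- Both sides agree at `w = 0`, so their derivatives there agree; in the direction
`w = c / (v - u)` the derivatives differ by `2 ‖c‖ ^ 2`. -/
lemma eq_of_eventually_norm_mul_add_sq_le {u v c : ℂ} (hc : c ≠ 0)
    (h : ∀ᶠ w in 𝓝 0, ‖u * w + c‖ ^ 2 ≤ ‖v * w + c‖ ^ 2) : u = v := by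
  by_contra hne
  have hsub : v - u ≠ 0 := sub_ne_zero.2 (Ne.symm hne)
  set w₀ := c / (v - u)
  have hderiv (x : ℂ) : HasDerivAt (fun t : ℝ => ‖x * (t * w₀) + c‖ ^ 2)
      (2 * inner ℝ c (x * w₀)) 0 := by
    have hlin : HasDerivAt (fun t : ℝ => x * (t * w₀) + c) (x * w₀) 0 := by
      simpa using (((Complex.ofRealCLM.hasDerivAt (x := 0)).mul_const w₀).const_mul x).add_const c
    simpa using hlin.norm_sq
  have hline : Tendsto (fun t : ℝ => (t : ℂ) * w₀) (𝓝 0) (𝓝 0) :=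
    Continuous.tendsto' (by fun_prop) _ _ (by simp)
  have hmin : IsLocalMin (fun t : ℝ => ‖v * (t * w₀) + c‖ ^ 2 - ‖u * (t * w₀) + c‖ ^ 2) 0 := by
    filter_upwards [hline.eventually h] with t ht
    simpa using ht
  have hzero := hmin.hasDerivAt_eq_zero ((hderiv v).sub (hderiv u))
  rw [← mul_sub, ← inner_sub_right, ← sub_mul, mul_div_cancel₀ _ hsub,
    real_inner_self_eq_norm_sq] at hzero
  simp [hc] at hzero

lemma StrongInterference.eq {hd hi hc : ℂ} (h : StrongInterference hd hi hc) (hne : hc ≠ 0) :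
    (‖hd‖ : ℂ) = hi :=
  eq_of_eventually_norm_mul_add_sq_le hne <| by
    filter_upwards [Metric.closedBall_mem_nhds 0 one_pos] with w hw
    exact h.norm_sq_le (mem_closedBall_zero_iff.1 hw)

end CIFC

end

theorem mainTheorem4_general {H : Matrix (Fin 3) (Fin 3) ℂ} (hrow : H 1 = H 0) (hne : H 0 2 ≠ 0)
    (hle : ‖H 2 2‖ ≤ ‖H 0 2‖) :
    ∃ R₁ R₂ : ℝ, CIFC.IFCCRAchievable H R₁ R₂ ∧ CIFC.BeamformingAchievable H R₁ R₂ ∧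
      CIFC.cmsSumCapacityOuterBound H ≤ ENNReal.ofReal (R₁ + R₂ + 3) := by
  set S := ∑ i, ‖H 0 i‖ with hS
  set T := (‖H 0 0‖ + ‖H 0 2‖ * √(1 / 2)) ^ 2 + (‖H 0 1‖ + ‖H 0 2‖ * √(1 / 2)) ^ 2
  have hTpos : 0 < T := by
    have := norm_pos_iff.2 hne
    positivity
  have hlt : (1 + S ^ 2) / 2 < 1 + T := by
    rw [hS, Fin.sum_univ_three]
    exact CIFC.half_one_add_sq_lt_beamforming (norm_nonneg _) (norm_nonneg _) (norm_nonneg _)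
  have hlog : Real.logb 2 ((1 + S ^ 2) / 2) = Real.logb 2 (1 + S ^ 2) - 1 := by
    rw [Real.logb_div (by positivity) two_ne_zero, Real.logb_self_eq_one one_lt_two]
  obtain ⟨R₁, R₂, hR, hach⟩ := CIFC.exists_beamformingAchievable hrow hne
    (le_max_left 0 (Real.logb 2 ((1 + S ^ 2) / 2)))
    (max_lt (Real.logb_pos one_lt_two (by linarith))
      (Real.logb_lt_logb one_lt_two (by positivity) hlt))
  refine ⟨R₁, R₂, hach.ifccrAchievable, hach, (CIFC.cmsSumCapacityOuterBound_le hrow hne hle).trans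
    (ENNReal.ofReal_le_ofReal ?_)⟩
  rw [hR]
  linarith [le_max_right 0 (Real.logb 2 ((1 + S ^ 2) / 2))]

theorem mainTheorem4 (hd hi hc h31 h32 h33 : ℂ) (hc_ne : hc ≠ 0)
    (h33_le : ‖h33‖ ^ 2 ≤ ‖hc‖ ^ 2) (hstrong : CIFC.StrongInterference hd hi hc) :
    ∃ R₁ R₂ : ℝ,
      CIFC.IFCCRAchievable (CIFC.symmetricGains hd hi hc h31 h32 h33) R₁ R₂ ∧
      CIFC.BeamformingAchievable (CIFC.symmetricGains hd hi hc h31 h32 h33) R₁ R₂ ∧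
      CIFC.cmsSumCapacityOuterBound (CIFC.symmetricGains hd hi hc h31 h32 h33) ≤
        ENNReal.ofReal (R₁ + R₂ + 3) :=
  mainTheorem4_general (by rw [← hstrong.eq hc_ne]; rfl) hc_ne
    ((pow_le_pow_iff_left₀ (norm_nonneg _) (norm_nonneg _) two_ne_zero).1 h33_le)
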